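/- Fix integers $d\ge 1$ and $N\ge 1$. A protocol for deterministic port-based teleportation (PBT) with input dimension $d$ and $N$ ports consists of a resource state $\rho_{AB^N}$, where Alice holds a finite-dimensional system $A$ and Bob holds the ports $B_1,\dots,B_N$ with $\mathcal H_{B_i}\cong\mathbb C^d$, and of a POVM $\{E_i\}_{i=1}^N$ of Alice on $A_0A$ with $\mathcal H_{A_0}\cong\mathbb C^d$. It implements the channel $$\Lambda_{A_0\to B_0}(X)=\sum_{i=1}^N \mathrm{id}_{B_i\to B_0}\operatorname{tr}_{A_0AB_i^c}\bigl[(E_i\otimes I_{B^N})(X_{A_0}\otimes\rho_{AB^N})\bigr].$$ Let $F(\Lambda)$ be its entanglement fidelity, i.e. the fidelity $F(\rho,\sigma)=\|\sqrt\rho\sqrt\sigma\|_1^2$ of $(\mathrm{id}\otimes\Lambda)(\phi^+)$ with the maximally entangled state $\phi^+$ of Schmidt rank $d$, and let $\varepsilon(\Lambda)=\|\Lambda-\mathrm{id}\|_\diamond$ be its diamond norm error, where $\|\Phi\|_\diamond=\sup_{\|X_{A_0'A_0}\|_1\le 1}\|(\mathrm{id}_{A_0'}\otimes\Phi)(X)\|_1$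 with $A_0'\cong A_0$. Let $F_d^*(N)$ and $\varepsilon_d^*(N)$ be the maximal entanglement fidelity and the minimal diamond norm error over all such protocols. Say that a channel $\Lambda'$ is no worse than $\Lambda$ if $F(\Lambda')\ge F(\Lambda)$, $\varepsilon(\Lambda')\le\varepsilon(\Lambda)$, and $f(\Lambda')\le f(\Lambda)$ for every real-valued convex function $f$ on the set of quantum channels on $\mathbb C^d$ such that $f\bigl(U\,\Phi(U^\dagger\,\cdot\,U)\,U^\dagger\bigr)=f(\Phi)$ for all channels $\Phi$ and all $U\in U(d)$. For $\zeta\in S_N$, let $\zeta$ also denote the operator on $(\mathbb C^d)^{\otimes N}$ that permutes the tensor factors, moving factor $i$ to position $\zeta(i)$. Call a unit vector $|\psi\rangle\in\mathcal H_{A^N}\otimes\mathcal H_{B^N}$, with $\mathcal H_{A_i}\cong\mathbb C^d$, symmetric if $(\zeta_{A^N}\otimes\zeta_{B^N})|\psi\rangle=|\psi\rangle$ for all $\zeta\in S_N$ (that is, $|\psi\rangle\in\mathrm{Sym}^N(\mathcal H_A\otimes\mathcal H_B)$) and $(U^{\otimes N}\otimes\overline U^{\otimes N})|\psi\rangle=|\psi\rangle$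 for all $U\in U(d)$. Call a POVM $\{E_i\}_{i=1}^N$ on $A_0A^N$ symmetric if $\zeta_{A^N}E_i\zeta_{A^N}^\dagger=E_{\zeta(i)}$ for all $\zeta\in S_N$ and all $i$, and $(U_{A_0}\otimes\overline U_A^{\otimes N})E_i(U_{A_0}\otimes\overline U_A^{\otimes N})^\dagger=E_i$ for all $U\in U(d)$ and all $i$. Then: 1. For every PBT protocol with channel $\Lambda$ there is a PBT protocol in which Alice's system is $A^N$, whose resource state is $|\psi\rangle\langle\psi|$ for a symmetric vector $|\psi\rangle$, which is a purification of a symmetric Werner state $\sigma_{B^N}$ (a state with $U^{\otimes N}\sigma(U^{\otimes N})^\dagger=\sigma$ for all $U\in U(d)$ and $\zeta\sigma\zeta^\dagger=\sigma$ for all $\zeta\in S_N$), whose POVM is symmetric, and whose channel $\Lambda'$ is unitarily covariant, $\Lambda'(X)=U\Lambda'(U^\dagger XU)U^\dagger$ for all $U\in U(d)$ and all $X$, and no worse than $\Lambda$. 2. For every PBT protocol whose resource state is $|\psi\rangle\langle\psi|$ with $|\psi\rangle$ symmetric there is a symmetric POVM which, used with the same resource state, gives a protocol whose channel is unitarily covariant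 and no worse than the channel of the original protocol. 3. The maximum $F_d^*(N)$ and the minimum $\varepsilon_d^*(N)$ are attained, they are unchanged and still attained if Alice's system is restricted to be $A^N$ with $\mathcal H_{A_i}\cong\mathbb C^d$, and $$\varepsilon_d^*(N)=2\bigl(1-F_d^*(N)\bigr).$$ -/

import Mathlib

open scoped Kronecker Matrix ComplexOrder

noncomputable section

namespace PBT

/-! ### Operators, states and channels in finite dimension

A quantum system with an orthonormal basis indexed by a finite type `a` has Hilbert space `a → ℂ`,
its operators are `Matrix a a ℂ`, and a composite system is indexed by the product type. -/

section General

variable {a b r : Type*} [Fintype a] [DecidableEq a] [Fintype b] [DecidableEq b]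
  [Fintype r] [DecidableEq r]

/-- A density operator: positive semidefinite with unit trace. -/
def IsState (ρ : Matrix a a ℂ) : Prop := ρ.PosSemidef ∧ ρ.trace = 1

/-- A POVM with outcomes in `ι`. -/
def IsPOVM {ι : Type*} [Fintype ι] (E : ι → Matrix a a ℂ) : Prop :=
  (∀ i, (E i).PosSemidef) ∧ ∑ i, E i = 1

/-- The rank-one operator `|ψ⟩⟨ψ|`. -/
def proj (ψ : a → ℂ) : Matrix a a ℂ := Matrix.vecMulVec ψ (star ψ)

/-- The square root of a positive semidefinite operator, by functional calculus. -/
def opSqrt (X : Matrix a a ℂ) : Matrix a a ℂ := cfc Real.sqrt X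

/-- The trace norm `‖X‖₁ = tr √(X† X)`. -/
def traceNorm (X : Matrix a a ℂ) : ℝ := (opSqrt (Xᴴ * X)).trace.re

/-- The fidelity `F(ρ, σ) = ‖√ρ √σ‖₁²`. -/
def stateFidelity (ρ σ : Matrix a a ℂ) : ℝ := traceNorm (opSqrt ρ * opSqrt σ) ^ 2

/-- `id ⊗ Λ`, with a reference system indexed by `r` as first factor. -/
def idTensor (r : Type*) (Λ : Matrix a a ℂ →ₗ[ℂ] Matrix b b ℂ) (X : Matrix (r × a) (r × a) ℂ) :
    Matrix (r × b) (r × b) ℂ :=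
  Matrix.of fun p q => Λ (Matrix.of fun k l => X (p.1, k) (q.1, l)) p.2 q.2

/-- Quantum channels: completely positive and trace preserving linear maps. -/
def IsChannel (Λ : Matrix a a ℂ →ₗ[ℂ] Matrix b b ℂ) : Prop :=
  (∀ (n : ℕ) (X : Matrix (Fin n × a) (Fin n × a) ℂ),
      X.PosSemidef → (idTensor (Fin n) Λ X).PosSemidef) ∧
    ∀ X : Matrix a a ℂ, (Λ X).trace = X.trace

/-- The maximally entangled unit vector of two copies of the system `a`. -/
def maxEntangled (a : Type*) [Fintype a] [DecidableEq a] : a × a → ℂ :=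
  fun p => if p.1 = p.2 then ((1 / Real.sqrt (Fintype.card a) : ℝ) : ℂ) else 0

/-- The entanglement fidelity `F(Λ₁, Λ₂)` of two maps. -/
def entFidelity₂ (Λ₁ Λ₂ : Matrix a a ℂ →ₗ[ℂ] Matrix b b ℂ) : ℝ :=
  stateFidelity (idTensor a Λ₁ (proj (maxEntangled a))) (idTensor a Λ₂ (proj (maxEntangled a)))

/-- The entanglement fidelity `F(Λ) = F(Λ, id)`. -/
def entFidelity (Λ : Matrix a a ℂ →ₗ[ℂ] Matrix a a ℂ) : ℝ := entFidelity₂ Λ LinearMap.id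

/-- The diamond norm; the reference system is a copy of the input system. -/
def diamondNorm (Λ : Matrix a a ℂ →ₗ[ℂ] Matrix b b ℂ) : ℝ :=
  sSup {x : ℝ | ∃ X : Matrix (a × a) (a × a) ℂ, traceNorm X ≤ 1 ∧ x = traceNorm (idTensor a Λ X)}

/-- The diamond distance of a map to the identity channel. -/
def diamondError (Λ : Matrix a a ℂ →ₗ[ℂ] Matrix a a ℂ) : ℝ := diamondNorm (Λ - LinearMap.id)

/-- Conjugation of a map with the unitary channel of `U`: the map `X ↦ U Λ(U† X U) U†`. -/
def unitaryConj (U : Matrix.unitaryGroup a ℂ) (Λ : Matrix a a ℂ →ₗ[ℂ] Matrix a a ℂ) :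
    Matrix a a ℂ →ₗ[ℂ] Matrix a a ℂ where
  toFun X := (U : Matrix a a ℂ) * Λ ((U : Matrix a a ℂ)ᴴ * X * (U : Matrix a a ℂ)) *
    (U : Matrix a a ℂ)ᴴ
  map_add' X Y := by simp [Matrix.mul_add, Matrix.add_mul]
  map_smul' c X := by simp

/-- `Λ` is unitarily covariant. -/
def IsCovariant (Λ : Matrix a a ℂ →ₗ[ℂ] Matrix a a ℂ) : Prop :=
  ∀ (U : Matrix.unitaryGroup a ℂ) (X : Matrix a a ℂ),
    Λ X = (U : Matrix a a ℂ) * Λ ((U : Matrix a a ℂ)ᴴ * X * (U : Matrix a a ℂ)) *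
      (U : Matrix a a ℂ)ᴴ

/-- A convex real function on quantum channels that is invariant under conjugation with
unitary channels. -/
def IsConvexInvariant (f : (Matrix a a ℂ →ₗ[ℂ] Matrix a a ℂ) → ℝ) : Prop :=
  ConvexOn ℝ {Λ : Matrix a a ℂ →ₗ[ℂ] Matrix a a ℂ | IsChannel Λ} f ∧
    ∀ Λ : Matrix a a ℂ →ₗ[ℂ] Matrix a a ℂ, IsChannel Λ →
      ∀ U : Matrix.unitaryGroup a ℂ, f (unitaryConj U Λ) = f Λ

/-- As an approximation of the identity, `Λ'` is no worse than `Λ`: with respect to the entanglement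
fidelity, to the diamond distance to the identity channel, and to every unitarily invariant convex
function on channels. -/
def NoWorse (Λ' Λ : Matrix a a ℂ →ₗ[ℂ] Matrix a a ℂ) : Prop :=
  entFidelity Λ ≤ entFidelity Λ' ∧ diamondError Λ' ≤ diamondError Λ ∧
    ∀ f : (Matrix a a ℂ →ₗ[ℂ] Matrix a a ℂ) → ℝ, IsConvexInvariant f → f Λ' ≤ f Λ

end General

/-! ### Tensor powers of `ℂ^d` -/

/-- Basis of `(ℂ^d)^{⊗ N}`. -/
abbrev Ports (d N : ℕ) : Type := Fin N → Fin d

/-- The operator `U^{⊗ N}` on `(ℂ^d)^{⊗ N}`. -/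
def tensorPow {d : ℕ} (N : ℕ) (U : Matrix (Fin d) (Fin d) ℂ) :
    Matrix (Ports d N) (Ports d N) ℂ :=
  Matrix.of fun x y => ∏ i, U (x i) (y i)

/-- The operator on `(ℂ^d)^{⊗ N}` that permutes the tensor factors, moving factor `i` to
position `ζ i`; it maps the basis vector `y` to `y ∘ ζ⁻¹`. -/
def permOp (d : ℕ) {N : ℕ} (ζ : Equiv.Perm (Fin N)) : Matrix (Ports d N) (Ports d N) ℂ :=
  Matrix.of fun x y => if x = y ∘ ζ.symm then 1 else 0

/-- Entrywise complex conjugate of a matrix. -/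
def conjMat {d : ℕ} (U : Matrix (Fin d) (Fin d) ℂ) : Matrix (Fin d) (Fin d) ℂ := U.map star

/-! ### Port-based teleportation -/

/-- A protocol for deterministic port-based teleportation with input dimension `d` and `N` ports.
Alice's part of the resource is an arbitrary finite-dimensional system (basis `a`), Bob's part
consists of the `N` ports. Alice measures the POVM on her input system and her part
of the resource. -/
structure Protocol (d N : ℕ) (a : Type*) [Fintype a] [DecidableEq a] where
  state : Matrix (a × Ports d N) (a × Ports d N) ℂ
  povm : Fin N → Matrix (Fin d × a) (Fin d × a) ℂ
  isState : IsState state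
  isPOVM : IsPOVM povm

section Protocols

variable {d N : ℕ} {a : Type*} [Fintype a] [DecidableEq a]

/-- The partial trace over everything except the port `B_i`, relabelled as the output system. -/
def tracePort (i : Fin N) {c : Type*} [Fintype c]
    (M : Matrix (c × Ports d N) (c × Ports d N) ℂ) : Matrix (Fin d) (Fin d) ℂ :=
  Matrix.of fun s t => ∑ k : c, ∑ y : Ports d N,
    if y i = s then M (k, y) (k, Function.update y i t) else 0

/-- The operator `X_{A₀} ⊗ ρ_{AB}` on `(A₀ A) B`. -/
def inputWithResource (X : Matrix (Fin d) (Fin d) ℂ)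
    (ρ : Matrix (a × Ports d N) (a × Ports d N) ℂ) :
    Matrix ((Fin d × a) × Ports d N) ((Fin d × a) × Ports d N) ℂ :=
  (X ⊗ₖ ρ).submatrix (Equiv.prodAssoc _ _ _) (Equiv.prodAssoc _ _ _)

/-- The channel from Alice's input to Bob's output that the protocol implements:
`Λ(X) = ∑ i, tr_{A₀ A B_i^c} [(E_i ⊗ 1_B) (X ⊗ ρ)]`. -/
def Protocol.channel (P : Protocol d N a) :
    Matrix (Fin d) (Fin d) ℂ →ₗ[ℂ] Matrix (Fin d) (Fin d) ℂ where
  toFun X := ∑ i, tracePort i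
    ((P.povm i ⊗ₖ (1 : Matrix (Ports d N) (Ports d N) ℂ)) * inputWithResource X P.state)
  map_add' X Y := by
    rw [← Finset.sum_add_distrib]
    refine Finset.sum_congr rfl fun i _ => ?_
    ext s t
    simp only [tracePort, inputWithResource, Matrix.add_kronecker, Matrix.submatrix_add,
      Pi.add_apply, Matrix.mul_add, Matrix.of_apply, Matrix.add_apply, ← Finset.sum_add_distrib]
    refine Finset.sum_congr rfl fun k _ => Finset.sum_congr rfl fun y _ => ?_
    split_ifs <;> simp
  map_smul' c X := by
    rw [RingHom.id_apply, Finset.smul_sum]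
    refine Finset.sum_congr rfl fun i _ => ?_
    ext s t
    simp only [tracePort, inputWithResource, Matrix.smul_kronecker, Matrix.submatrix_smul,
      Pi.smul_apply, Matrix.mul_smul, Matrix.of_apply, Matrix.smul_apply, Finset.smul_sum]
    refine Finset.sum_congr rfl fun k _ => Finset.sum_congr rfl fun y _ => ?_
    split_ifs <;> simp

/-- The reduced state on Bob's ports. -/
def bobMarginal (ρ : Matrix (a × Ports d N) (a × Ports d N) ℂ) :
    Matrix (Ports d N) (Ports d N) ℂ :=
  Matrix.of fun x y => ∑ k : a, ρ (k, x) (k, y)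

/-- Symmetric Werner states: invariant under `U^{⊗ N}` and under permutations of the factors. -/
def IsSymmetricWerner (σ : Matrix (Ports d N) (Ports d N) ℂ) : Prop :=
  IsState σ ∧
  (∀ U : Matrix.unitaryGroup (Fin d) ℂ,
    tensorPow N (U : Matrix (Fin d) (Fin d) ℂ) * σ *
      (tensorPow N (U : Matrix (Fin d) (Fin d) ℂ))ᴴ = σ) ∧
  ∀ ζ : Equiv.Perm (Fin N), permOp d ζ * σ * (permOp d ζ)ᴴ = σ

/-- A vector of `A^N B^N` in `Sym^N(A ⊗ B)` that is invariant under `U^{⊗ N} ⊗ Ū^{⊗ N}`. -/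
def IsSymmetricVector (ψ : Ports d N × Ports d N → ℂ) : Prop :=
  (∀ ζ : Equiv.Perm (Fin N), (permOp d ζ ⊗ₖ permOp d ζ) *ᵥ ψ = ψ) ∧
  ∀ U : Matrix.unitaryGroup (Fin d) ℂ,
    (tensorPow N (U : Matrix (Fin d) (Fin d) ℂ) ⊗ₖ
      tensorPow N (conjMat (U : Matrix (Fin d) (Fin d) ℂ))) *ᵥ ψ = ψ

/-- The `U(d) × S_N` symmetry of a family of operators on `A₀ A^N` indexed by the ports:
`ζ E_i ζ† = E_{ζ(i)}` and `(U ⊗ Ū^{⊗ N}) E_i (U ⊗ Ū^{⊗ N})† = E_i`. -/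
def IsSymmetricPOVM (E : Fin N → Matrix (Fin d × Ports d N) (Fin d × Ports d N) ℂ) : Prop :=
  (∀ (ζ : Equiv.Perm (Fin N)) (i : Fin N),
    ((1 : Matrix (Fin d) (Fin d) ℂ) ⊗ₖ permOp d ζ) * E i *
      ((1 : Matrix (Fin d) (Fin d) ℂ) ⊗ₖ permOp d ζ)ᴴ = E (ζ i)) ∧
  ∀ (U : Matrix.unitaryGroup (Fin d) ℂ) (i : Fin N),
    ((U : Matrix (Fin d) (Fin d) ℂ) ⊗ₖ
        tensorPow N (conjMat (U : Matrix (Fin d) (Fin d) ℂ))) * E i *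
      ((U : Matrix (Fin d) (Fin d) ℂ) ⊗ₖ
        tensorPow N (conjMat (U : Matrix (Fin d) (Fin d) ℂ)))ᴴ = E i

end Protocols

/-- The entanglement fidelities of all protocols, Alice's system being of any finite dimension. -/
def fidelities (d N : ℕ) : Set ℝ :=
  {x | ∃ (n : ℕ) (P : Protocol d N (Fin n)), x = entFidelity P.channel}

/-- The diamond norm errors of all protocols, Alice's system being of any finite dimension. -/
def errors (d N : ℕ) : Set ℝ :=
  {x | ∃ (n : ℕ) (P : Protocol d N (Fin n)), x = diamondError P.channel}

/-- The entanglement fidelities of the protocols in which Alice's system is `A^N`, `A_i ≅ ℂ^d`. -/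
def portFidelities (d N : ℕ) : Set ℝ :=
  {x | ∃ P : Protocol d N (Ports d N), x = entFidelity P.channel}

/-- The diamond norm errors of the protocols in which Alice's system is `A^N`, `A_i ≅ ℂ^d`. -/
def portErrors (d N : ℕ) : Set ℝ :=
  {x | ∃ P : Protocol d N (Ports d N), x = diamondError P.channel}

/-- The optimal entanglement fidelity `F_d^*(N)`. -/
def optFidelity (d N : ℕ) : ℝ := sSup (fidelities d N)

/-- The optimal diamond norm error `ε_d^*(N)`. -/
def optError (d N : ℕ) : ℝ := sInf (errors d N)

end PBT

end

namespace PBT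

set_option linter.unusedSectionVars false

/-! ### Functional calculus of positive semidefinite matrices, polar decomposition, trace norm. -/

section TraceNorm

variable {a b r : Type*} [Fintype a] [DecidableEq a] [Fintype b] [DecidableEq b]
  [Fintype r] [DecidableEq r]

/-! A protocol enters only through the operators `effectChoi ρ (E i)` on A₀B^N, the Choi operators
of the maps that the single outcomes induce. They are positive and sum to 1 ⊗ ρ_B, and the channel
is a linear function `portChannel` of them. Conversely, every positive family with sum 1 ⊗ σ is
produced by measuring the canonical purification of σ (`exists_protocol_effectChoi_eq`). So Alice's
system can be taken to be A^N, and symmetrizing a protocol means symmetrizing a point of a convex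
set.

The group U(d) × S_N acts on these families: permutations leave the channel alone, and unitaries
conjugate it (`portChannel_symAct`). In place of a Haar integral, take the point of least
Hilbert-Schmidt norm in the convex hull of the orbit. The hull is compact and the squared norm is
strictly convex and invariant, so this point is unique and hence fixed
(`exists_fixed_mem_convexHull`). The new channel is a finite mixture of unitary conjugates of the
old one, so no convex invariant function increases. A fixed family has a symmetric Werner marginal,
whose canonical purification is a symmetric vector. For a symmetric vector the action on POVMs
matches the action on Choi operators (`effectChoi_symAct`), so a second averaging, now of the POVM
with the resource held fixed, gives a symmetric POVM and a covariant channel.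

Every channel satisfies ε ≥ 2(1 - F), by testing on the maximally entangled state
(`two_mul_one_sub_entFidelity_le`). Equality holds for covariant channels, because Λ - F·id is then
completely positive (`IsChannel.exists_cp_of_isCovariant`). Since -F is itself convex and invariant,
the fidelity and diamond clauses of `NoWorse` follow from the clause on convex functions
(`noWorse_of_isCovariant`). Compactness gives a maximizer of F with Alice's system A^N; symmetrizing
it attains all the optima and relates them. -/

lemma continuousOn_spectrum (X : Matrix a a ℂ) (f : ℝ → ℝ) : ContinuousOn f (spectrum ℝ X) :=
  Matrix.finite_real_spectrum.continuousOn f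

lemma cfc_mul_cfc (f g : ℝ → ℝ) (X : Matrix a a ℂ) :
    cfc f X * cfc g X = cfc (fun t => f t * g t) X :=
  (cfc_mul f g X (continuousOn_spectrum X f) (continuousOn_spectrum X g)).symm

lemma conjTranspose_cfc (f : ℝ → ℝ) (X : Matrix a a ℂ) : (cfc f X)ᴴ = cfc f X :=
  (cfc_predicate f X : IsSelfAdjoint (cfc f X))

lemma spectrum_nonneg {X : Matrix a a ℂ} (hX : X.PosSemidef) : ∀ t ∈ spectrum ℝ X, 0 ≤ t := by
  intro t ht
  obtain ⟨i, rfl⟩ := hX.1.spectrum_real_eq_range_eigenvalues ▸ ht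
  exact hX.eigenvalues_nonneg i

lemma cfc_congr_of_posSemidef {X : Matrix a a ℂ} (hX : X.PosSemidef) {f g : ℝ → ℝ}
    (h : ∀ t, 0 ≤ t → f t = g t) : cfc f X = cfc g X :=
  cfc_congr fun t ht => h t (spectrum_nonneg hX t ht)

lemma cfc_eq_self {X : Matrix a a ℂ} (hX : X.PosSemidef) {f : ℝ → ℝ} (h : ∀ t, 0 ≤ t → f t = t) :
    cfc f X = X := by
  rw [cfc_congr_of_posSemidef hX (g := id) h]
  exact cfc_id ℝ X hX.1

lemma posSemidef_cfc {X : Matrix a a ℂ} (hX : X.PosSemidef) {f : ℝ → ℝ} (h : ∀ t, 0 ≤ t → 0 ≤ f t) :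
    (cfc f X).PosSemidef := by
  have : cfc f X = (cfc (fun t => √(f t)) X)ᴴ * cfc (fun t => √(f t)) X := by
    rw [conjTranspose_cfc, cfc_mul_cfc]
    exact cfc_congr_of_posSemidef hX fun t ht => (Real.mul_self_sqrt (h t ht)).symm
  rw [this]
  exact Matrix.posSemidef_conjTranspose_mul_self _

/-- The pseudo-inverse of the square root. -/
noncomputable def opSqrtInv (X : Matrix a a ℂ) : Matrix a a ℂ := cfc (fun t => (√t)⁻¹) X

/-- The projection onto the support of a positive semidefinite operator. -/
noncomputable def supp (X : Matrix a a ℂ) : Matrix a a ℂ :=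
  cfc (fun t : ℝ => if t = 0 then 0 else 1) X

lemma opSqrt_posSemidef {X : Matrix a a ℂ} (hX : X.PosSemidef) : (opSqrt X).PosSemidef :=
  posSemidef_cfc hX fun t _ => Real.sqrt_nonneg t

lemma conjTranspose_opSqrt (X : Matrix a a ℂ) : (opSqrt X)ᴴ = opSqrt X := conjTranspose_cfc _ _

lemma conjTranspose_opSqrtInv (X : Matrix a a ℂ) : (opSqrtInv X)ᴴ = opSqrtInv X :=
  conjTranspose_cfc _ _

lemma conjTranspose_supp (X : Matrix a a ℂ) : (supp X)ᴴ = supp X := conjTranspose_cfc _ _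

lemma opSqrt_mul_opSqrt {X : Matrix a a ℂ} (hX : X.PosSemidef) : opSqrt X * opSqrt X = X := by
  rw [opSqrt, cfc_mul_cfc]
  exact cfc_eq_self hX fun t ht => Real.mul_self_sqrt ht

lemma opSqrtInv_mul_opSqrt {X : Matrix a a ℂ} (hX : X.PosSemidef) :
    opSqrtInv X * opSqrt X = supp X := by
  rw [opSqrt, opSqrtInv, cfc_mul_cfc]
  refine cfc_congr_of_posSemidef hX fun t ht => ?_
  split_ifs with h
  · simp [h]
  · exact inv_mul_cancel₀ (Real.sqrt_ne_zero'.2 (lt_of_le_of_ne ht (Ne.symm h)))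

lemma opSqrt_mul_opSqrtInv {X : Matrix a a ℂ} (hX : X.PosSemidef) :
    opSqrt X * opSqrtInv X = supp X := by
  rw [← opSqrtInv_mul_opSqrt hX, opSqrt, opSqrtInv, cfc_mul_cfc, cfc_mul_cfc]
  simp only [mul_comm]

lemma supp_mul_supp (X : Matrix a a ℂ) : supp X * supp X = supp X := by
  rw [supp, cfc_mul_cfc]
  congr 1
  ext t
  split_ifs <;> simp

lemma supp_mul_opSqrt {X : Matrix a a ℂ} (hX : X.PosSemidef) : supp X * opSqrt X = opSqrt X := by
  rw [supp, opSqrt, cfc_mul_cfc]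
  refine cfc_congr_of_posSemidef hX fun t ht => ?_
  split_ifs with h <;> simp [h]

lemma opSqrt_mul_supp {X : Matrix a a ℂ} (hX : X.PosSemidef) : opSqrt X * supp X = opSqrt X := by
  simpa [conjTranspose_opSqrt, conjTranspose_supp] using
    congrArg Matrix.conjTranspose (supp_mul_opSqrt hX)

lemma supp_mul_self {X : Matrix a a ℂ} (hX : X.PosSemidef) : supp X * X = X := by
  have h : supp X * (opSqrt X * opSqrt X) = opSqrt X * opSqrt X := by
    rw [← mul_assoc, supp_mul_opSqrt hX]
  rwa [opSqrt_mul_opSqrt hX] at h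

lemma self_mul_supp {X : Matrix a a ℂ} (hX : X.PosSemidef) : X * supp X = X := by
  simpa [hX.1.eq, conjTranspose_supp] using congrArg Matrix.conjTranspose (supp_mul_self hX)

lemma opSqrtInv_mul_supp {X : Matrix a a ℂ} (hX : X.PosSemidef) :
    opSqrtInv X * supp X = opSqrtInv X := by
  rw [supp, opSqrtInv, cfc_mul_cfc]
  refine cfc_congr_of_posSemidef hX fun t ht => ?_
  split_ifs with h <;> simp [h]

lemma opSqrtInv_mul_self_mul {X : Matrix a a ℂ} (hX : X.PosSemidef) :
    opSqrtInv X * X * opSqrtInv X = supp X := by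
  have h : opSqrtInv X * (opSqrt X * opSqrt X) * opSqrtInv X = supp X := by
    rw [← mul_assoc, mul_assoc, opSqrtInv_mul_opSqrt hX, opSqrt_mul_opSqrtInv hX, supp_mul_supp]
  rwa [opSqrt_mul_opSqrt hX] at h

/-- Uniqueness of the positive square root: to evaluate a trace norm below it is enough to write X†X
as the square of a positive operator. -/
lemma opSqrt_sq {S : Matrix a a ℂ} (hS : S.PosSemidef) : opSqrt (S * S) = S := by
  have h : S * S = cfc (fun t : ℝ => t * t) S := by
    rw [← cfc_mul_cfc, show cfc (fun t : ℝ => t) S = S from cfc_id ℝ S hS.1]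
  rw [h, opSqrt]
  refine (cfc_comp Real.sqrt (fun t : ℝ => t * t) S hS.1
    ((Matrix.finite_real_spectrum.image _).continuousOn _)
    (continuousOn_spectrum _ _)).symm.trans ?_
  exact cfc_eq_self hS fun t ht => Real.sqrt_mul_self ht

/-- A unitary that fixes `X` under conjugation fixes `√X`. -/
lemma conj_opSqrt {X V : Matrix a a ℂ} (hX : X.PosSemidef) (hV : Vᴴ * V = 1)
    (h : V * X * Vᴴ = X) : V * opSqrt X * Vᴴ = opSqrt X := by
  rw [← opSqrt_sq ((opSqrt_posSemidef hX).mul_mul_conjTranspose_same V)]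
  congr 1
  calc V * opSqrt X * Vᴴ * (V * opSqrt X * Vᴴ)
      = V * opSqrt X * (Vᴴ * V) * (opSqrt X * Vᴴ) := by simp only [mul_assoc]
    _ = V * (opSqrt X * opSqrt X) * Vᴴ := by rw [hV]; simp only [mul_assoc, one_mul]
    _ = X := by rw [opSqrt_mul_opSqrt hX, h]

/-- A polar decomposition in which the partial isometry vanishes on the kernel. -/
noncomputable def polarPart (X : Matrix a a ℂ) : Matrix a a ℂ := X * opSqrtInv (Xᴴ * X)

/-- The absolute value `√(X† X)`. -/
noncomputable def opAbs (X : Matrix a a ℂ) : Matrix a a ℂ := opSqrt (Xᴴ * X)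

lemma traceNorm_eq_opAbs (X : Matrix a a ℂ) : traceNorm X = (opAbs X).trace.re := rfl

lemma opAbs_posSemidef (X : Matrix a a ℂ) : (opAbs X).PosSemidef :=
  opSqrt_posSemidef (Matrix.posSemidef_conjTranspose_mul_self X)

lemma trace_opAbs (X : Matrix a a ℂ) : (opAbs X).trace = traceNorm X := by
  have := (opAbs_posSemidef X).trace_nonneg
  rw [traceNorm_eq_opAbs]
  exact Complex.ext rfl (by simpa using (Complex.le_def.1 this).2.symm)

/-- X and X†X have the same kernel: X(1 - supp) vanishes because its product with its own adjoint
does. -/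
lemma self_mul_supp_abs (X : Matrix a a ℂ) : X * supp (Xᴴ * X) = X := by
  have h := self_mul_supp (Matrix.posSemidef_conjTranspose_mul_self X)
  have : (X * (1 - supp (Xᴴ * X)))ᴴ * (X * (1 - supp (Xᴴ * X))) = 0 := by
    rw [Matrix.conjTranspose_mul, mul_assoc, ← mul_assoc Xᴴ, mul_sub (Xᴴ * X), h]
    simp
  rw [Matrix.conjTranspose_mul_self_eq_zero, mul_sub, mul_one, sub_eq_zero] at this
  exact this.symm

lemma polarPart_mul_opAbs (X : Matrix a a ℂ) : polarPart X * opAbs X = X := by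
  rw [polarPart, opAbs, mul_assoc,
    opSqrtInv_mul_opSqrt (Matrix.posSemidef_conjTranspose_mul_self X), self_mul_supp_abs]

lemma polarPart_adjoint_mul (X : Matrix a a ℂ) :
    (polarPart X)ᴴ * polarPart X = supp (Xᴴ * X) := by
  rw [polarPart, Matrix.conjTranspose_mul, conjTranspose_opSqrtInv, mul_assoc, ← mul_assoc Xᴴ,
    ← mul_assoc, opSqrtInv_mul_self_mul (Matrix.posSemidef_conjTranspose_mul_self X)]

lemma polarPart_adjoint_mul_self (X : Matrix a a ℂ) : (polarPart X)ᴴ * X = opAbs X := by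
  conv_lhs => rw [← polarPart_mul_opAbs X]
  rw [← mul_assoc, polarPart_mul_opAbs, polarPart_adjoint_mul, opAbs,
    supp_mul_opSqrt (Matrix.posSemidef_conjTranspose_mul_self X)]

lemma polarPart_projection (X : Matrix a a ℂ) :
    polarPart X * (polarPart X)ᴴ * (polarPart X * (polarPart X)ᴴ) =
      polarPart X * (polarPart X)ᴴ := by
  rw [mul_assoc, ← mul_assoc _ (polarPart X), polarPart_adjoint_mul, ← mul_assoc, polarPart,
    mul_assoc X, opSqrtInv_mul_supp (Matrix.posSemidef_conjTranspose_mul_self X)]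

/-- With the polar decomposition X = WP, the block operator is (W; 1) P (W; 1)†. Together with
`traceNorm_le_of_fromBlocks` this describes 2‖X‖₁ as the least value of tr A + tr B over positive
completions. That description is linear in all the data, so the triangle inequality and the
behaviour under completely positive maps can be read off from it. -/
lemma exists_posSemidef_fromBlocks (X : Matrix a a ℂ) : ∃ A B : Matrix a a ℂ,
    (Matrix.fromBlocks A X Xᴴ B).PosSemidef ∧ A.trace = traceNorm X ∧ B.trace = traceNorm X := by
  set W := polarPart X with hW
  set P := opAbs X with hP
  have hPs : P.PosSemidef := opAbs_posSemidef X
  refine ⟨W * P * Wᴴ, P, ?_, ?_, trace_opAbs X⟩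
  · have := hPs.mul_mul_conjTranspose_same (Matrix.fromRows W (1 : Matrix a a ℂ))
    have h : P * Wᴴ = Xᴴ := by
      rw [← hPs.1.eq, ← Matrix.conjTranspose_mul, hW, hP, polarPart_mul_opAbs]
    have h' : W * P = X := polarPart_mul_opAbs X
    rw [Matrix.fromRows_mul, Matrix.conjTranspose_fromRows_eq_fromCols_conjTranspose,
      Matrix.fromRows_mul_fromCols, Matrix.conjTranspose_one, mul_one, mul_one, one_mul, h] at this
    simpa only [h'] using this
  · rw [Matrix.trace_mul_comm, ← mul_assoc, polarPart_adjoint_mul, hP, opAbs,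
      supp_mul_opSqrt (Matrix.posSemidef_conjTranspose_mul_self X)]
    exact trace_opAbs X

lemma trace_mul_re_nonneg {n : Type*} [Fintype n] {X Y : Matrix n n ℂ} (hX : X.PosSemidef)
    (hY : Y.PosSemidef) : 0 ≤ (X * Y).trace.re := by
  classical
  rw [← opSqrt_mul_opSqrt hX, mul_assoc, Matrix.trace_mul_comm]
  have := (hY.mul_mul_conjTranspose_same (opSqrt X)).trace_nonneg
  rw [conjTranspose_opSqrt] at this
  exact (Complex.le_def.1 this).1

lemma trace_fromBlocks (A B C D : Matrix a a ℂ) :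
    (Matrix.fromBlocks A B C D).trace = A.trace + D.trace := by
  simp [Matrix.trace, Fintype.sum_sum_type]

/-- Testing a positive semidefinite block operator against `(-W, 1)`. -/
lemma re_trace_mul_adjoint_le {A B Y W : Matrix a a ℂ}
    (h : (Matrix.fromBlocks A Y Yᴴ B).PosSemidef) :
    2 * (Y * Wᴴ).trace.re ≤ (A * (W * Wᴴ)).trace.re + B.trace.re := by
  have hW := Matrix.posSemidef_self_mul_conjTranspose (Matrix.fromRows (-W) (1 : Matrix a a ℂ))
  have := trace_mul_re_nonneg h hW
  rw [Matrix.conjTranspose_fromRows_eq_fromCols_conjTranspose, Matrix.fromRows_mul_fromCols,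
    Matrix.fromBlocks_multiply, trace_fromBlocks] at this
  have h2 : (Yᴴ * W).trace.re = (Y * Wᴴ).trace.re := by
    rw [← Matrix.trace_mul_comm Wᴴ Y, ← Complex.conj_re, starRingEnd_apply,
      ← Matrix.trace_conjTranspose]
    simp
  simp only [Matrix.conjTranspose_neg, Matrix.conjTranspose_one, mul_one, one_mul, neg_mul_neg,
    Matrix.mul_neg, Matrix.trace_add, Matrix.trace_neg, Complex.add_re, Complex.neg_re, h2] at this
  linarith

/-- Take W to be the polar part of Y. It is only a partial isometry, so WW† is a projection Q rather
than 1; positivity of A and of 1 - Q allows Q to be replaced by 1 in the bound. -/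
lemma traceNorm_le_of_fromBlocks {A B Y : Matrix a a ℂ}
    (h : (Matrix.fromBlocks A Y Yᴴ B).PosSemidef) :
    2 * traceNorm Y ≤ A.trace.re + B.trace.re := by
  have h1 := re_trace_mul_adjoint_le (W := polarPart Y) h
  rw [Matrix.trace_mul_comm, polarPart_adjoint_mul_self, ← traceNorm_eq_opAbs] at h1
  have hA : A.PosSemidef := h.submatrix Sum.inl
  set Q := polarPart Y * (polarPart Y)ᴴ
  have hQ : Qᴴ = Q := by simp [Q]
  have hQ2 : (1 - Q).PosSemidef := by
    have := Matrix.posSemidef_conjTranspose_mul_self (1 - Q)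
    rwa [Matrix.conjTranspose_sub, hQ, Matrix.conjTranspose_one, sub_mul, one_mul, mul_sub,
      polarPart_projection, mul_one, sub_self, sub_zero] at this
  have h2 := trace_mul_re_nonneg hA hQ2
  rw [mul_sub, mul_one, Matrix.trace_sub, Complex.sub_re] at h2
  linarith

lemma re_trace_mul_unitary_le (Y : Matrix a a ℂ) {W : Matrix a a ℂ} (hW : W * Wᴴ = 1) :
    (Y * Wᴴ).trace.re ≤ traceNorm Y := by
  obtain ⟨A, B, h, hA, hB⟩ := exists_posSemidef_fromBlocks Y
  have := re_trace_mul_adjoint_le (W := W) h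
  rw [hW, mul_one, hA, hB, Complex.ofReal_re] at this
  linarith

lemma traceNorm_neg (X : Matrix a a ℂ) : traceNorm (-X) = traceNorm X := by
  simp [traceNorm]

lemma traceNorm_add_le (X Y : Matrix a a ℂ) : traceNorm (X + Y) ≤ traceNorm X + traceNorm Y := by
  obtain ⟨A, B, h, hA, hB⟩ := exists_posSemidef_fromBlocks X
  obtain ⟨A', B', h', hA', hB'⟩ := exists_posSemidef_fromBlocks Y
  have h3 := h.add h'
  rw [Matrix.fromBlocks_add, ← Matrix.conjTranspose_add] at h3
  have := traceNorm_le_of_fromBlocks h3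
  simp only [Matrix.trace_add, hA, hB, hA', hB', Complex.add_re, Complex.ofReal_re] at this
  linarith

lemma traceNorm_sub_le (X Y : Matrix a a ℂ) : traceNorm (X - Y) ≤ traceNorm X + traceNorm Y := by
  rw [sub_eq_add_neg, ← traceNorm_neg Y]
  exact traceNorm_add_le _ _

lemma traceNorm_of_posSemidef {X : Matrix a a ℂ} (hX : X.PosSemidef) :
    traceNorm X = X.trace.re := by
  rw [traceNorm, hX.1.eq, opSqrt_sq hX]

lemma traceNorm_smul {c : ℝ} (hc : 0 ≤ c) (X : Matrix a a ℂ) :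
    traceNorm ((c : ℂ) • X) = c * traceNorm X := by
  have h : ((c : ℂ) • X)ᴴ * ((c : ℂ) • X) = ((c : ℂ) • opAbs X) * ((c : ℂ) • opAbs X) := by
    rw [Matrix.conjTranspose_smul]
    simp only [Matrix.smul_mul, Matrix.mul_smul, opAbs,
      opSqrt_mul_opSqrt (Matrix.posSemidef_conjTranspose_mul_self X)]
    simp
  have hp : ((c : ℂ) • opAbs X).PosSemidef :=
    (opAbs_posSemidef X).smul (by exact_mod_cast hc)
  rw [traceNorm, h, opSqrt_sq hp, Matrix.trace_smul, smul_eq_mul, Complex.re_ofReal_mul,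
    ← traceNorm_eq_opAbs]

end TraceNorm

/-! ### Completely positive maps, Choi operators and contraction of the trace norm. -/

section Channels

variable {a b c r : Type*} [Fintype a] [DecidableEq a] [Fintype b] [DecidableEq b]
  [Fintype c] [DecidableEq c] [Fintype r] [DecidableEq r]

/-- Complete positivity. -/
def IsCP (Λ : Matrix a a ℂ →ₗ[ℂ] Matrix b b ℂ) : Prop :=
  ∀ (n : ℕ) (X : Matrix (Fin n × a) (Fin n × a) ℂ),
      X.PosSemidef → (idTensor (Fin n) Λ X).PosSemidef

lemma idTensor_add (Λ Φ : Matrix a a ℂ →ₗ[ℂ] Matrix b b ℂ) (X : Matrix (r × a) (r × a) ℂ) :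
    idTensor r (Λ + Φ) X = idTensor r Λ X + idTensor r Φ X := rfl

lemma idTensor_sub (Λ Φ : Matrix a a ℂ →ₗ[ℂ] Matrix b b ℂ) (X : Matrix (r × a) (r × a) ℂ) :
    idTensor r (Λ - Φ) X = idTensor r Λ X - idTensor r Φ X := rfl

lemma idTensor_smul (t : ℝ) (Λ : Matrix a a ℂ →ₗ[ℂ] Matrix b b ℂ) (X : Matrix (r × a) (r × a) ℂ) :
    idTensor r (t • Λ) X = (t : ℂ) • idTensor r Λ X := rfl

lemma idTensor_id (X : Matrix (r × a) (r × a) ℂ) :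
    idTensor r (LinearMap.id : Matrix a a ℂ →ₗ[ℂ] Matrix a a ℂ) X = X := rfl

lemma IsCP.add {Λ Φ : Matrix a a ℂ →ₗ[ℂ] Matrix b b ℂ} (hΛ : IsCP Λ) (hΦ : IsCP Φ) :
    IsCP (Λ + Φ) := fun n X hX => by
  rw [idTensor_add]
  exact (hΛ n X hX).add (hΦ n X hX)

lemma IsCP.smul {Λ : Matrix a a ℂ →ₗ[ℂ] Matrix b b ℂ} (hΛ : IsCP Λ) {t : ℝ} (ht : 0 ≤ t) :
    IsCP (t • Λ) := fun n X hX => by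
  rw [idTensor_smul]
  exact (hΛ n X hX).smul (by exact_mod_cast ht)

lemma isCP_zero : IsCP (0 : Matrix a a ℂ →ₗ[ℂ] Matrix b b ℂ) := fun _ _ _ => .zero

lemma isCP_sum {ι : Type*} (s : Finset ι) {Λ : ι → Matrix a a ℂ →ₗ[ℂ] Matrix b b ℂ}
    (h : ∀ i ∈ s, IsCP (Λ i)) : IsCP (∑ i ∈ s, Λ i) :=
  Finset.sum_induction _ IsCP (fun _ _ => IsCP.add) isCP_zero h

lemma IsCP.comp {Φ : Matrix b b ℂ →ₗ[ℂ] Matrix c c ℂ} {Λ : Matrix a a ℂ →ₗ[ℂ] Matrix b b ℂ}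
    (hΦ : IsCP Φ) (hΛ : IsCP Λ) : IsCP (Φ ∘ₗ Λ) := fun n X hX =>
  hΦ n _ (hΛ n X hX)

/-- The map `X ↦ K X K†`. -/
noncomputable def krausMap (K : Matrix b a ℂ) : Matrix a a ℂ →ₗ[ℂ] Matrix b b ℂ where
  toFun X := K * X * Kᴴ
  map_add' X Y := by simp [Matrix.mul_add, Matrix.add_mul]
  map_smul' c X := by simp

lemma idTensor_krausMap (K : Matrix b a ℂ) (X : Matrix (r × a) (r × a) ℂ) :
    idTensor r (krausMap K) X =
      ((1 : Matrix r r ℂ) ⊗ₖ K) * X * ((1 : Matrix r r ℂ) ⊗ₖ K)ᴴ := by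
  ext ⟨p, i⟩ ⟨q, j⟩
  simp [idTensor, krausMap, Matrix.mul_apply, Fintype.sum_prod_type, Matrix.one_apply, apply_ite]

lemma isCP_krausMap (K : Matrix b a ℂ) : IsCP (krausMap K) := fun n X hX => by
  rw [idTensor_krausMap]
  exact hX.mul_mul_conjTranspose_same _

/-- Complete positivity is tested only on reference systems `Fin n`; relabelling the basis extends
it to every finite reference. -/
lemma IsCP.idTensor_posSemidef {Λ : Matrix a a ℂ →ₗ[ℂ] Matrix b b ℂ} (hΛ : IsCP Λ)
    {X : Matrix (r × a) (r × a) ℂ} (hX : X.PosSemidef) : (idTensor r Λ X).PosSemidef := by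
  let e := Fintype.equivFin r
  have h := hΛ _ _ (hX.submatrix (Prod.map e.symm id))
  convert h.submatrix (Prod.map e id) using 1
  ext ⟨p, i⟩ ⟨q, j⟩
  simp [idTensor]

/-- A 2 × 2 block operator over r × a is an operator over (r ⊕ r) × a, so this is complete
positivity with reference r ⊕ r. That the map commutes with the adjoint is read off from the
hermiticity of the result. -/
lemma IsCP.idTensor_fromBlocks {Λ : Matrix a a ℂ →ₗ[ℂ] Matrix b b ℂ} (hΛ : IsCP Λ)
    {A B X : Matrix (r × a) (r × a) ℂ} (h : (Matrix.fromBlocks A X Xᴴ B).PosSemidef) :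
    (Matrix.fromBlocks (idTensor r Λ A) (idTensor r Λ X) (idTensor r Λ X)ᴴ
      (idTensor r Λ B)).PosSemidef := by
  have h2 := (hΛ.idTensor_posSemidef (h.submatrix (Equiv.sumProdDistrib r r a))).submatrix
    (Equiv.sumProdDistrib r r b).symm
  have h3 : (Matrix.fromBlocks (idTensor r Λ A) (idTensor r Λ X) (idTensor r Λ Xᴴ)
      (idTensor r Λ B)).PosSemidef := by
    convert h2 using 1
    ext i j
    rcases i with ⟨p, i⟩ | ⟨p, i⟩ <;> rcases j with ⟨q, j⟩ | ⟨q, j⟩ <;> rfl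
  have h4 := (Matrix.isHermitian_fromBlocks_iff.1 h3.1).2.1
  rwa [← h4] at h3

lemma trace_idTensor {Λ : Matrix a a ℂ →ₗ[ℂ] Matrix b b ℂ} {t : ℂ}
    (h : ∀ X, (Λ X).trace = t * X.trace) (X : Matrix (r × a) (r × a) ℂ) :
    (idTensor r Λ X).trace = t * X.trace := by
  simp only [Matrix.trace, Fintype.sum_prod_type, Finset.mul_sum]
  refine Finset.sum_congr rfl fun p _ => ?_
  have := h (Matrix.of fun k l => X (p, k) (p, l))
  simpa [Matrix.trace, Finset.mul_sum, idTensor] using this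

/-- The map sends an optimal positive completion of X to a completion of its image, with traces
scaled by t. Besides channels, where t = 1, this is needed for Λ - F·id, where t = 1 - F. -/
lemma IsCP.traceNorm_idTensor_le {Λ : Matrix a a ℂ →ₗ[ℂ] Matrix b b ℂ} (hΛ : IsCP Λ) {t : ℝ}
    (h : ∀ X, (Λ X).trace = t * X.trace) (X : Matrix (r × a) (r × a) ℂ) :
    traceNorm (idTensor r Λ X) ≤ t * traceNorm X := by
  obtain ⟨A, B, hb, hA, hB⟩ := exists_posSemidef_fromBlocks X
  have := traceNorm_le_of_fromBlocks (hΛ.idTensor_fromBlocks hb)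
  rw [trace_idTensor h, trace_idTensor h, hA, hB, Complex.re_ofReal_mul, Complex.ofReal_re] at this
  linarith

/-- The Choi operator. -/
def choi (Λ : Matrix a a ℂ →ₗ[ℂ] Matrix b b ℂ) : Matrix (a × b) (a × b) ℂ :=
  Matrix.of fun p q => Λ (Matrix.single p.1 q.1 1) p.2 q.2

lemma apply_eq_sum_choi (Λ : Matrix a a ℂ →ₗ[ℂ] Matrix b b ℂ) (X : Matrix a a ℂ) (i j : b) :
    Λ X i j = ∑ k, ∑ l, X k l * choi Λ (k, i) (l, j) := by
  conv_lhs => rw [Matrix.matrix_eq_sum_single X]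
  simp only [map_sum, Matrix.sum_apply]
  refine Finset.sum_congr rfl fun k _ => Finset.sum_congr rfl fun l _ => ?_
  rw [← mul_one (X k l), ← smul_eq_mul, ← Matrix.smul_single, map_smul]
  simp [choi]

/-- The columns of the square root of the Choi operator, reshaped into matrices, are Kraus operators
of Λ. -/
lemma isCP_of_choi {Λ : Matrix a a ℂ →ₗ[ℂ] Matrix b b ℂ} (h : (choi Λ).PosSemidef) : IsCP Λ := by
  set S := opSqrt (choi Λ) with hS
  have hS2 : S * Sᴴ = choi Λ := by rw [hS, conjTranspose_opSqrt, opSqrt_mul_opSqrt h]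
  have : Λ = ∑ m, krausMap (Matrix.of fun i k => S (k, i) m) := by
    ext X i j
    rw [apply_eq_sum_choi, ← hS2]
    simp only [LinearMap.sum_apply, Matrix.sum_apply, krausMap, LinearMap.coe_mk, AddHom.coe_mk,
      Matrix.mul_apply, Matrix.of_apply, Matrix.conjTranspose_apply, Finset.mul_sum, Finset.sum_mul]
    rw [Finset.sum_comm_cycle]
    refine Finset.sum_congr rfl fun m _ => ?_
    rw [Finset.sum_comm]
    exact Finset.sum_congr rfl fun l _ => Finset.sum_congr rfl fun k _ => by ring
  rw [this]
  exact isCP_sum _ fun m _ => isCP_krausMap _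

lemma convex_isChannel : Convex ℝ {Λ : Matrix a a ℂ →ₗ[ℂ] Matrix b b ℂ | IsChannel Λ} := by
  intro Λ hΛ Φ hΦ s t hs ht hst
  refine ⟨IsCP.add (IsCP.smul hΛ.1 hs) (IsCP.smul hΦ.1 ht), fun X => ?_⟩
  simp only [LinearMap.add_apply, LinearMap.smul_apply, Matrix.trace_add, Matrix.trace_smul, hΛ.2 X,
    hΦ.2 X, ← add_smul, hst, one_smul]

lemma unitaryConj_eq (U : Matrix.unitaryGroup a ℂ) (Λ : Matrix a a ℂ →ₗ[ℂ] Matrix a a ℂ) :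
    unitaryConj U Λ = krausMap (U : Matrix a a ℂ) ∘ₗ Λ ∘ₗ krausMap (U : Matrix a a ℂ)ᴴ := by
  ext X
  simp [unitaryConj, krausMap]

lemma unitary_adjoint_mul (U : Matrix.unitaryGroup a ℂ) :
    (U : Matrix a a ℂ)ᴴ * (U : Matrix a a ℂ) = 1 := Matrix.UnitaryGroup.star_mul_self U

lemma unitary_mul_adjoint (U : Matrix.unitaryGroup a ℂ) :
    (U : Matrix a a ℂ) * (U : Matrix a a ℂ)ᴴ = 1 := Matrix.mem_unitaryGroup_iff.1 U.2

lemma IsChannel.unitaryConj {Λ : Matrix a a ℂ →ₗ[ℂ] Matrix a a ℂ} (h : IsChannel Λ)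
    (U : Matrix.unitaryGroup a ℂ) : IsChannel (unitaryConj U Λ) := by
  refine ⟨?_, fun X => ?_⟩
  · rw [unitaryConj_eq]
    exact (isCP_krausMap _).comp (IsCP.comp h.1 (isCP_krausMap _))
  · change ((U : Matrix a a ℂ) * Λ ((U : Matrix a a ℂ)ᴴ * X * (U : Matrix a a ℂ)) *
      (U : Matrix a a ℂ)ᴴ).trace = _
    rw [Matrix.trace_mul_comm, ← mul_assoc, unitary_adjoint_mul, one_mul, h.2,
      Matrix.trace_mul_comm, ← mul_assoc, unitary_mul_adjoint, one_mul]

/-! ### Entanglement fidelity -/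

lemma inv_sqrt_mul_inv_sqrt (n : ℕ) :
    ((√(n : ℝ) : ℝ) : ℂ)⁻¹ * ((√(n : ℝ) : ℝ) : ℂ)⁻¹ = (n : ℂ)⁻¹ := by
  rw [← mul_inv, ← Complex.ofReal_mul, Real.mul_self_sqrt (Nat.cast_nonneg _),
    Complex.ofReal_natCast]

lemma idTensor_maxEntangled (Λ : Matrix a a ℂ →ₗ[ℂ] Matrix b b ℂ) :
    idTensor a Λ (proj (maxEntangled a)) = (Fintype.card a : ℂ)⁻¹ • choi Λ := by
  have h (k l : a) : (Matrix.of fun k' l' => proj (maxEntangled a) (k, k') (l, l')) =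
      (Fintype.card a : ℂ)⁻¹ • Matrix.single k l (1 : ℂ) := by
    have := inv_sqrt_mul_inv_sqrt (Fintype.card a)
    ext k' l'
    by_cases h1 : k = k' <;> by_cases h2 : l = l' <;>
      simp [proj, Matrix.vecMulVec_apply, maxEntangled, Matrix.single, h1, h2, this]
  ext ⟨k, i⟩ ⟨l, j⟩
  simp only [idTensor, Matrix.of_apply, h, map_smul, choi, Matrix.smul_apply]

lemma star_maxEntangled_dotProduct [Nonempty a] :
    star (maxEntangled a) ⬝ᵥ maxEntangled a = 1 := by
  have h := inv_sqrt_mul_inv_sqrt (Fintype.card a)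
  simp [dotProduct, Fintype.sum_prod_type, maxEntangled, apply_ite, h]

lemma proj_posSemidef (ψ : a → ℂ) : (proj ψ).PosSemidef := Matrix.posSemidef_vecMulVec_self_star ψ

lemma trace_mul_proj (J : Matrix a a ℂ) (ψ : a → ℂ) :
    (J * proj ψ).trace = star ψ ⬝ᵥ (J *ᵥ ψ) := by
  rw [proj, Matrix.mul_vecMulVec, Matrix.trace_vecMulVec, dotProduct_comm]

lemma proj_mul_mul_proj (J : Matrix a a ℂ) (ψ : a → ℂ) :
    proj ψ * J * proj ψ = (J * proj ψ).trace • proj ψ := by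
  rw [trace_mul_proj, proj, mul_assoc, Matrix.mul_vecMulVec, Matrix.vecMulVec_mul_vecMulVec]
  ext i j
  simp only [Matrix.vecMulVec_apply, Matrix.smul_apply, Pi.smul_apply, smul_eq_mul]
  ring

lemma trace_proj {ψ : a → ℂ} (h : star ψ ⬝ᵥ ψ = 1) : (proj ψ).trace = 1 := by
  rw [proj, Matrix.trace_vecMulVec, dotProduct_comm, h]

lemma proj_mul_proj {ψ : a → ℂ} (h : star ψ ⬝ᵥ ψ = 1) : proj ψ * proj ψ = proj ψ := by
  have := proj_mul_mul_proj 1 ψ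
  rwa [mul_one, one_mul, trace_proj h, one_smul] at this

lemma trace_mul_proj_nonneg {J : Matrix a a ℂ} (hJ : J.PosSemidef) (ψ : a → ℂ) :
    0 ≤ (J * proj ψ).trace := by
  rw [trace_mul_proj]
  exact hJ.dotProduct_mulVec_nonneg ψ

/-- The fidelity with a pure state is the overlap. -/
lemma stateFidelity_proj {J : Matrix a a ℂ} (hJ : J.PosSemidef) {ψ : a → ℂ}
    (h : star ψ ⬝ᵥ ψ = 1) : stateFidelity J (proj ψ) = (J * proj ψ).trace.re := by
  have hc := trace_mul_proj_nonneg hJ ψ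
  obtain ⟨x, hx⟩ : ∃ x : ℝ, (J * proj ψ).trace = x :=
    ⟨_, Complex.ext rfl (by simpa using (Complex.le_def.1 hc).2.symm)⟩
  have hx0 : 0 ≤ x := by rw [hx] at hc; exact_mod_cast hc
  have h1 : opSqrt (proj ψ) = proj ψ := by
    conv_lhs => rw [← proj_mul_proj h]
    exact opSqrt_sq (proj_posSemidef ψ)
  have h2 : (opSqrt J * proj ψ)ᴴ * (opSqrt J * proj ψ) =
      ((√x : ℝ) • proj ψ) * ((√x : ℝ) • proj ψ) := by
    rw [Matrix.conjTranspose_mul, conjTranspose_opSqrt, (proj_posSemidef ψ).1.eq, mul_assoc,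
      ← mul_assoc (opSqrt J), opSqrt_mul_opSqrt hJ, ← mul_assoc, proj_mul_mul_proj, hx,
      smul_mul_smul_comm, proj_mul_proj h, Real.mul_self_sqrt hx0]
    rfl
  have h3 : ((√x : ℝ) • proj ψ).PosSemidef := (proj_posSemidef ψ).smul (Real.sqrt_nonneg x)
  rw [stateFidelity, h1, traceNorm, h2, opSqrt_sq h3, Matrix.trace_smul, trace_proj h, hx]
  simp [Real.sq_sqrt hx0]

lemma idTensor_id_maxEntangled :
    idTensor a (LinearMap.id : Matrix a a ℂ →ₗ[ℂ] Matrix a a ℂ) (proj (maxEntangled a)) =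
      proj (maxEntangled a) := rfl

lemma entFidelity_eq_trace_mul_proj [Nonempty a] {Λ : Matrix a a ℂ →ₗ[ℂ] Matrix a a ℂ}
    (h : IsChannel Λ) : entFidelity Λ =
      (idTensor a Λ (proj (maxEntangled a)) * proj (maxEntangled a)).trace.re :=
  stateFidelity_proj (IsCP.idTensor_posSemidef h.1 (proj_posSemidef _))
    star_maxEntangled_dotProduct

lemma proj_maxEntangled_apply (k i l j : a) : proj (maxEntangled a) (k, i) (l, j) =
    if k = i ∧ l = j then (Fintype.card a : ℂ)⁻¹ else 0 := by
  rw [← idTensor_id_maxEntangled, idTensor_maxEntangled]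
  simp [choi, Matrix.single]

lemma entFidelity_eq_sum [Nonempty a] {Λ : Matrix a a ℂ →ₗ[ℂ] Matrix a a ℂ} (h : IsChannel Λ) :
    entFidelity Λ =
      ((Fintype.card a : ℂ)⁻¹ ^ 2 * ∑ k, ∑ l, Λ (Matrix.single k l 1) k l).re := by
  rw [entFidelity_eq_trace_mul_proj h, idTensor_maxEntangled]
  congr 1
  simp only [Matrix.trace, Matrix.diag_apply, Matrix.mul_apply, Fintype.sum_prod_type,
    Matrix.smul_apply, smul_eq_mul, proj_maxEntangled_apply, Finset.mul_sum]
  simp only [ite_and, mul_ite, mul_zero, Finset.sum_ite_eq, Finset.mem_univ, if_true,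
    choi]
  refine Finset.sum_congr rfl fun k _ => ?_
  rw [Finset.sum_comm]
  refine Finset.sum_congr rfl fun l _ => ?_
  simp only [Finset.sum_ite_eq, Finset.mem_univ, if_true, Matrix.of_apply]
  ring

lemma stdBasis_repr_apply (M : Matrix a b ℂ) (i : a) (j : b) :
    (Matrix.stdBasis ℂ a b).repr M (i, j) = M i j := by
  simp [Matrix.stdBasis]

/-- Written as a multiple of the trace of Λ as a linear operator on matrices, F is visibly affine in
Λ, and cyclicity makes it invariant under unitary conjugation. -/
lemma entFidelity_eq_trace [Nonempty a] {Λ : Matrix a a ℂ →ₗ[ℂ] Matrix a a ℂ} (h : IsChannel Λ) :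
    entFidelity Λ =
      ((Fintype.card a : ℂ)⁻¹ ^ 2 * LinearMap.trace ℂ (Matrix a a ℂ) Λ).re := by
  rw [entFidelity_eq_sum h, LinearMap.trace_eq_matrix_trace ℂ (Matrix.stdBasis ℂ a a),
    Matrix.trace, Fintype.sum_prod_type]
  simp only [Matrix.diag_apply, LinearMap.toMatrix_apply, Matrix.stdBasis_eq_single,
    stdBasis_repr_apply]

lemma trace_unitaryConj (U : Matrix.unitaryGroup a ℂ) (Λ : Matrix a a ℂ →ₗ[ℂ] Matrix a a ℂ) :
    LinearMap.trace ℂ (Matrix a a ℂ) (unitaryConj U Λ) = LinearMap.trace ℂ (Matrix a a ℂ) Λ := by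
  rw [unitaryConj_eq, LinearMap.trace_comp_comm']
  congr 1
  ext X : 1
  simp [krausMap, ← mul_assoc, unitary_adjoint_mul]
  simp [mul_assoc, unitary_adjoint_mul]

lemma isConvexInvariant_neg_entFidelity [Nonempty a] :
    IsConvexInvariant (fun Λ : Matrix a a ℂ →ₗ[ℂ] Matrix a a ℂ => -entFidelity Λ) := by
  refine ⟨⟨convex_isChannel, fun Λ hΛ Φ hΦ s t hs ht hst => le_of_eq ?_⟩, fun Λ hΛ U => ?_⟩
  · dsimp only
    rw [entFidelity_eq_trace (convex_isChannel hΛ hΦ hs ht hst), entFidelity_eq_trace hΛ,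
      entFidelity_eq_trace hΦ, map_add]
    rw [show s • Λ = (s : ℂ) • Λ from rfl, show t • Φ = (t : ℂ) • Φ from rfl, map_smul, map_smul]
    simp only [smul_eq_mul, mul_add, Complex.add_re, mul_left_comm _ (Complex.ofReal _),
      Complex.re_ofReal_mul]
    ring
  · dsimp only
    rw [entFidelity_eq_trace (hΛ.unitaryConj U), trace_unitaryConj, entFidelity_eq_trace hΛ]

/-! ### Diamond distance to the identity -/

lemma IsChannel.traceNorm_idTensor_sub_id_le {Λ : Matrix a a ℂ →ₗ[ℂ] Matrix a a ℂ}
    (h : IsChannel Λ) (X : Matrix (r × a) (r × a) ℂ) :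
    traceNorm (idTensor r (Λ - LinearMap.id) X) ≤ 2 * traceNorm X := by
  have h1 := IsCP.traceNorm_idTensor_le (r := r) h.1 (t := 1) (fun X => by simp [h.2 X]) X
  have h2 := traceNorm_sub_le (idTensor r Λ X) X
  rw [idTensor_sub, idTensor_id]
  linarith

lemma two_mul_one_sub_entFidelity_le [Nonempty a] {Λ : Matrix a a ℂ →ₗ[ℂ] Matrix a a ℂ}
    (h : IsChannel Λ) : 2 * (1 - entFidelity Λ) ≤ diamondError Λ := by
  set P := proj (maxEntangled a) with hP
  have hφ := star_maxEntangled_dotProduct (a := a)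
  have hPP : P * P = P := proj_mul_proj hφ
  have hPh : Pᴴ = P := (proj_posSemidef _).1
  have hP1 : P.trace = 1 := trace_proj hφ
  refine le_trans ?_ (le_csSup (a := traceNorm (idTensor a (Λ - LinearMap.id) P)) ⟨2, ?_⟩
    ⟨P, ?_, rfl⟩)
  -- Test J - P, with J the normalized Choi operator, against the reflection 1 - 2P: the trace of (J
  -- - P)(1 - 2P) is 1 - 2F - 1 + 2 = 2(1 - F).
  · set W : Matrix (a × a) (a × a) ℂ := 1 - (2 : ℂ) • P with hW
    have hWh : Wᴴ = W := by simp [hW, hPh]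
    have hWW : W * Wᴴ = 1 := by
      rw [hWh, hW, sub_mul, one_mul, mul_sub, mul_one, smul_mul_smul_comm, hPP]
      module
    have h1 := re_trace_mul_unitary_le (idTensor a (Λ - LinearMap.id) P) hWW
    have h2 : (idTensor a Λ P).trace = 1 := by
      rw [trace_idTensor (t := 1) (fun X => by rw [h.2 X, one_mul]), hP1, one_mul]
    rw [hWh, hW, idTensor_sub, idTensor_id, mul_sub, mul_one, mul_smul_comm, sub_mul, hPP,
      Matrix.trace_sub, Matrix.trace_smul, Matrix.trace_sub, Matrix.trace_sub, h2, hP1] at h1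
    rw [entFidelity_eq_trace_mul_proj h, ← hP]
    refine le_trans (le_of_eq ?_) h1
    simp
    ring
  · rintro x ⟨X, hX, rfl⟩
    have := h.traceNorm_idTensor_sub_id_le (r := a) X
    linarith
  · rw [traceNorm_of_posSemidef (proj_posSemidef _), ← hP, hP1, Complex.one_re]

/-- The permutation matrix of `e` as a unitary. -/
noncomputable def permUnitary (e : Equiv.Perm a) : Matrix.unitaryGroup a ℂ :=
  ⟨(1 : Matrix a a ℂ).submatrix e id, by
    rw [Matrix.mem_unitaryGroup_iff, Matrix.star_eq_conjTranspose]
    ext i j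
    simp [Matrix.mul_apply, Matrix.one_apply, apply_ite]⟩

/-- The diagonal unitary with entry `-1` at `k` and `1` elsewhere. -/
noncomputable def reflectionUnitary (k : a) : Matrix.unitaryGroup a ℂ :=
  ⟨Matrix.diagonal fun i => if i = k then -1 else 1, by
    rw [Matrix.mem_unitaryGroup_iff, Matrix.star_eq_conjTranspose, Matrix.diagonal_conjTranspose,
      Matrix.diagonal_mul_diagonal, ← Matrix.diagonal_one]
    congr 1
    ext i
    by_cases h : i = k <;> simp [h]⟩

lemma IsCovariant.apply_single_perm {Λ : Matrix a a ℂ →ₗ[ℂ] Matrix a a ℂ} (h : IsCovariant Λ)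
    (e : Equiv.Perm a) (k l i j : a) :
    Λ (Matrix.single k l 1) i j = Λ (Matrix.single (e k) (e l) 1) (e i) (e j) := by
  have hs : (permUnitary e : Matrix a a ℂ)ᴴ * Matrix.single k l (1 : ℂ) *
      (permUnitary e : Matrix a a ℂ) = Matrix.single (e k) (e l) 1 := by
    ext p q
    simp only [permUnitary, Matrix.mul_apply, Matrix.single, Matrix.one_apply,
      Matrix.conjTranspose_apply, Matrix.submatrix_apply, Matrix.of_apply, id]
    rw [Finset.sum_eq_single l (fun j _ hj => by simp [Ne.symm hj]) (by simp),
      Finset.sum_eq_single k (fun j _ hj => by simp [Ne.symm hj]) (by simp)]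
    by_cases hp : e k = p <;> by_cases hq : e l = q <;> simp [hp, hq]
  rw [h (permUnitary e) (Matrix.single k l 1), hs]
  simp [permUnitary, Matrix.mul_apply, Matrix.one_apply, apply_ite]

/-- Covariance under the reflection at k: index k contributes a sign on the input side, row i
contributes none on the output side, and the signs of l cancel. The entry equals its own negative.
-/
lemma IsCovariant.apply_single_eq_zero {Λ : Matrix a a ℂ →ₗ[ℂ] Matrix a a ℂ} (h : IsCovariant Λ)
    {k i : a} (hik : i ≠ k) (l : a) : Λ (Matrix.single k l 1) i l = 0 := by
  have hs : (reflectionUnitary k : Matrix a a ℂ)ᴴ * Matrix.single k l (1 : ℂ) *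
      (reflectionUnitary k : Matrix a a ℂ) =
      (-(if l = k then -1 else 1 : ℂ)) • Matrix.single k l 1 := by
    ext p q
    by_cases hp : k = p <;> by_cases hq : l = q <;>
      simp [reflectionUnitary, Matrix.single, hp, hq, Matrix.diagonal_conjTranspose]
    by_cases h : q = p <;> simp [h]
  have h1 := congrFun₂ (h (reflectionUnitary k) (Matrix.single k l 1)) i l
  rw [hs, map_smul] at h1
  by_cases hl : l = k <;>
    simp [reflectionUnitary, Matrix.diagonal_conjTranspose, hik, hl] at h1 ⊢ <;>
    linear_combination (1 / 2 : ℂ) * h1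

/-- The maximally entangled vector is an eigenvector of the Choi operator of a covariant map. -/
lemma IsCovariant.choi_mul_proj [Nonempty a] {Λ : Matrix a a ℂ →ₗ[ℂ] Matrix a a ℂ}
    (h : IsCovariant Λ) : idTensor a Λ (proj (maxEntangled a)) * proj (maxEntangled a) =
      (idTensor a Λ (proj (maxEntangled a)) * proj (maxEntangled a)).trace •
        proj (maxEntangled a) := by
  obtain ⟨k₀⟩ := ‹Nonempty a›
  set m : ℂ := ∑ l, Λ (Matrix.single k₀ l 1) k₀ l with hm
  have hk (k : a) : ∑ l, Λ (Matrix.single k l 1) k l = m := by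
    rw [hm]
    refine Fintype.sum_equiv (Equiv.swap k k₀) _ _ fun l => ?_
    rw [h.apply_single_perm (Equiv.swap k k₀), Equiv.swap_apply_left]
  -- Applied to the maximally entangled vector, the Choi operator has (k, i) component proportional
  -- to the sum over l of Λ(|k⟩⟨l|)_{il}. Reflections make it vanish for i ≠ k, and permutations
  -- make it independent of k for i = k. No other unitaries are needed.
  have key : ∃ t : ℂ, idTensor a Λ (proj (maxEntangled a)) * proj (maxEntangled a) =
      t • proj (maxEntangled a) := by
    refine ⟨(Fintype.card a : ℂ)⁻¹ * m, ?_⟩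
    rw [idTensor_maxEntangled]
    ext ⟨k, i⟩ ⟨l, j⟩
    simp only [Matrix.smul_apply, Matrix.mul_apply, Fintype.sum_prod_type,
      proj_maxEntangled_apply, smul_eq_mul, choi, Matrix.of_apply]
    by_cases hl : l = j
    · by_cases hki : k = i
      · subst hki
        simp [hl, ← hk k, Finset.mul_sum, mul_comm]
      · simp [hl, hki, h.apply_single_eq_zero (Ne.symm hki)]
    · simp [hl]
  obtain ⟨t, ht⟩ := key
  have : Nonempty a := ⟨k₀⟩
  rw [ht, Matrix.trace_smul, trace_proj star_maxEntangled_dotProduct, smul_eq_mul, mul_one]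

/-- The maximally entangled vector is an eigenvector of the normalized Choi operator J with
eigenvalue F, so J - F·P equals the compression (1 - P)J(1 - P) and is positive. Its trace is 1 - F,
which gives the bound on F. -/
lemma IsChannel.exists_cp_of_isCovariant [Nonempty a] {Λ : Matrix a a ℂ →ₗ[ℂ] Matrix a a ℂ}
    (h : IsChannel Λ) (hc : IsCovariant Λ) :
    IsCP (Λ - entFidelity Λ • LinearMap.id) ∧ entFidelity Λ ≤ 1 := by
  set P := proj (maxEntangled a) with hP
  set J := idTensor a Λ P with hJ
  have hφ := star_maxEntangled_dotProduct (a := a)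
  have hPP : P * P = P := proj_mul_proj hφ
  have hPh : Pᴴ = P := (proj_posSemidef _).1
  have hP1 : P.trace = 1 := trace_proj hφ
  have hJp : J.PosSemidef := IsCP.idTensor_posSemidef h.1 (proj_posSemidef _)
  have hF : (J * P).trace = entFidelity Λ := by
    rw [entFidelity_eq_trace_mul_proj h]
    exact Complex.ext rfl (by
      simpa using (Complex.le_def.1 (trace_mul_proj_nonneg hJp (maxEntangled a))).2.symm)
  have hJP : J * P = (entFidelity Λ : ℂ) • P := by rw [← hF]; exact hc.choi_mul_proj
  have hPJ : P * J = (entFidelity Λ : ℂ) • P := by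
    have := congrArg Matrix.conjTranspose hJP
    simpa [hPh, hJp.1.eq] using this
  have hpos := hJp.mul_mul_conjTranspose_same (1 - P)
  have hid : (1 - P) * J * (1 - P)ᴴ = J - (entFidelity Λ : ℂ) • P := by
    rw [Matrix.conjTranspose_sub, Matrix.conjTranspose_one, hPh, sub_mul, one_mul, hPJ, mul_sub,
      mul_one, sub_mul, hJP, smul_mul_assoc, hPP, sub_self, sub_zero]
  rw [hid] at hpos
  have hJ1 : J.trace = 1 := by
    rw [hJ, trace_idTensor (t := 1) (fun X => by rw [h.2 X, one_mul]), hP1, one_mul]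
  constructor
  · apply isCP_of_choi
    have hN : idTensor a (Λ - entFidelity Λ • LinearMap.id) P = J - (entFidelity Λ : ℂ) • P := rfl
    have hd : (Fintype.card a : ℂ) ≠ 0 := by simp
    rw [← hN, hP, idTensor_maxEntangled] at hpos
    have := hpos.smul (a := (Fintype.card a : ℂ)) (by positivity)
    rwa [smul_smul, mul_inv_cancel₀ hd, one_smul] at this
  · have := hpos.trace_nonneg
    rw [Matrix.trace_sub, Matrix.trace_smul, hJ1, hP1, smul_eq_mul, mul_one, sub_nonneg] at this
    exact_mod_cast this

/-- For covariant channels the diamond distance to the identity is a function of the entanglement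
fidelity. -/
lemma IsChannel.diamondError_of_isCovariant [Nonempty a] {Λ : Matrix a a ℂ →ₗ[ℂ] Matrix a a ℂ}
    (h : IsChannel Λ) (hc : IsCovariant Λ) : diamondError Λ = 2 * (1 - entFidelity Λ) := by
  refine le_antisymm (csSup_le ⟨_, 0, ?_, rfl⟩ ?_) (two_mul_one_sub_entFidelity_le h)
  · rw [traceNorm_of_posSemidef .zero]
    simp
  · rintro x ⟨X, hX, rfl⟩
    obtain ⟨hN, hF⟩ := h.exists_cp_of_isCovariant hc
    have h1 := hN.traceNorm_idTensor_le (r := a) (t := 1 - entFidelity Λ)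
      (fun X => by simp [Matrix.trace_sub, h.2 X, sub_mul]) X
    -- Λ - id = (Λ - F·id) - (1 - F)·id is a difference of two completely positive maps that both
    -- scale traces by 1 - F.
    have h2 : idTensor a (Λ - LinearMap.id) X =
        idTensor a (Λ - entFidelity Λ • LinearMap.id) X -
          ((1 - entFidelity Λ : ℝ) : ℂ) • X := by
      rw [idTensor_sub, idTensor_sub, idTensor_smul, idTensor_id]
      push_cast
      module
    rw [h2]
    have h3 := traceNorm_sub_le (idTensor a (Λ - entFidelity Λ • LinearMap.id) X)
      (((1 - entFidelity Λ : ℝ) : ℂ) • X)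
    rw [traceNorm_smul (sub_nonneg.2 hF)] at h3
    have h4 := mul_le_mul_of_nonneg_left hX (sub_nonneg.2 hF)
    linarith

/-- The choice f = -F gives the fidelity clause. Then ε(Λ') = 2(1 - F(Λ')) ≤ 2(1 - F(Λ)) ≤ ε(Λ), so
convexity and invariance of the diamond norm are not needed. -/
lemma noWorse_of_isCovariant [Nonempty a] {Λ Λ' : Matrix a a ℂ →ₗ[ℂ] Matrix a a ℂ}
    (h : IsChannel Λ) (h' : IsChannel Λ') (hc : IsCovariant Λ')
    (hf : ∀ f : (Matrix a a ℂ →ₗ[ℂ] Matrix a a ℂ) → ℝ, IsConvexInvariant f → f Λ' ≤ f Λ) :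
    NoWorse Λ' Λ := by
  have hF : entFidelity Λ ≤ entFidelity Λ' :=
    neg_le_neg_iff.1 (hf _ isConvexInvariant_neg_entFidelity)
  refine ⟨hF, ?_, hf⟩
  have := two_mul_one_sub_entFidelity_le h
  rw [h'.diamondError_of_isCovariant hc]
  linarith

/-- A convex invariant function does not increase under mixtures of unitary conjugates. -/
lemma IsConvexInvariant.le_of_mem_convexHull {f : (Matrix a a ℂ →ₗ[ℂ] Matrix a a ℂ) → ℝ}
    (hf : IsConvexInvariant f) {Λ Λ' : Matrix a a ℂ →ₗ[ℂ] Matrix a a ℂ} (h : IsChannel Λ)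
    (h' : Λ' ∈ convexHull ℝ (Set.range fun U => unitaryConj U Λ)) : f Λ' ≤ f Λ := by
  obtain ⟨y, ⟨U, rfl⟩, hy⟩ := hf.1.exists_ge_of_mem_convexHull
    (Set.range_subset_iff.2 fun U => h.unitaryConj U) h'
  exact hy.trans_eq (hf.2 Λ h U)

end Channels

/-! ### Product operators on the ports and the partial trace onto one port. -/

section TensorFamilies

variable {d N : ℕ}

/-- The tensor product of a family of operators on the ports. -/
def tensorFam (A : Fin N → Matrix (Fin d) (Fin d) ℂ) : Matrix (Ports d N) (Ports d N) ℂ :=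
  Matrix.of fun x y => ∏ j, A j (x j) (y j)

lemma tensorPow_eq_tensorFam (U : Matrix (Fin d) (Fin d) ℂ) :
    tensorPow N U = tensorFam fun _ => U := rfl

lemma tensorFam_mul (A B : Fin N → Matrix (Fin d) (Fin d) ℂ) :
    tensorFam A * tensorFam B = tensorFam fun j => A j * B j := by
  ext x y
  simp only [tensorFam, Matrix.mul_apply, Matrix.of_apply, ← Finset.prod_mul_distrib]
  rw [Fintype.prod_sum]

lemma conjTranspose_tensorFam (A : Fin N → Matrix (Fin d) (Fin d) ℂ) :
    (tensorFam A)ᴴ = tensorFam fun j => (A j)ᴴ := by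
  ext x y
  simp [tensorFam]

lemma tensorFam_one : tensorFam (fun _ => 1 : Fin N → Matrix (Fin d) (Fin d) ℂ) = 1 := by
  ext x y
  simp only [tensorFam, Matrix.of_apply, Matrix.one_apply, Finset.prod_ite_zero, Finset.mem_univ,
    true_imp_iff, Finset.prod_const_one, funext_iff]

lemma tensorPow_mul (U V : Matrix (Fin d) (Fin d) ℂ) :
    tensorPow N U * tensorPow N V = tensorPow N (U * V) := tensorFam_mul _ _

lemma conjTranspose_tensorPow (U : Matrix (Fin d) (Fin d) ℂ) :
    (tensorPow N U)ᴴ = tensorPow N Uᴴ := conjTranspose_tensorFam _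

lemma tensorPow_one : tensorPow N (1 : Matrix (Fin d) (Fin d) ℂ) = 1 := tensorFam_one

/-- The operator that acts as `A` on port `i` and trivially on the others. -/
def atPort (i : Fin N) (A : Matrix (Fin d) (Fin d) ℂ) : Matrix (Ports d N) (Ports d N) ℂ :=
  tensorFam (Function.update (fun _ => 1) i A)

lemma atPort_apply (i : Fin N) (A : Matrix (Fin d) (Fin d) ℂ) (x y : Ports d N) :
    atPort i A x y = if ∀ j, j ≠ i → x j = y j then A (x i) (y i) else 0 := by
  rw [atPort, tensorFam, Matrix.of_apply, ← Finset.mul_prod_erase _ _ (Finset.mem_univ i),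
    Function.update_self]
  have : ∏ j ∈ Finset.univ.erase i, Function.update (fun _ => (1 : Matrix (Fin d) (Fin d) ℂ)) i A j
      (x j) (y j) = ∏ j ∈ Finset.univ.erase i, if x j = y j then 1 else 0 :=
    Finset.prod_congr rfl fun j hj => by
      rw [Function.update_of_ne (Finset.ne_of_mem_erase hj), Matrix.one_apply]
  rw [this, Finset.prod_ite_zero]
  simp

lemma atPort_add (i : Fin N) (A B : Matrix (Fin d) (Fin d) ℂ) :
    atPort i (A + B) = atPort i A + atPort i B := by
  ext x y
  simp only [atPort_apply, Matrix.add_apply]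
  split_ifs <;> simp

lemma atPort_smul (i : Fin N) (t : ℂ) (A : Matrix (Fin d) (Fin d) ℂ) :
    atPort i (t • A) = t • atPort i A := by
  ext x y
  simp [atPort_apply]

lemma atPort_one (i : Fin N) : atPort i (1 : Matrix (Fin d) (Fin d) ℂ) = 1 := by
  rw [atPort, Function.update_eq_self_iff.2 rfl, tensorFam_one]

lemma tensorPow_conj_atPort (i : Fin N) {V : Matrix (Fin d) (Fin d) ℂ} (hV : Vᴴ * V = 1)
    (A : Matrix (Fin d) (Fin d) ℂ) :
    (tensorPow N V)ᴴ * atPort i A * tensorPow N V = atPort i (Vᴴ * A * V) := by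
  rw [conjTranspose_tensorPow, tensorPow_eq_tensorFam, tensorPow_eq_tensorFam, atPort,
    tensorFam_mul, tensorFam_mul, atPort]
  congr 1
  ext j : 1
  by_cases h : j = i
  · subst h; simp
  · simp [h, hV]

lemma sum_atPort_mul (i : Fin N) (A : Matrix (Fin d) (Fin d) ℂ) (y : Ports d N)
    (f : Ports d N → ℂ) :
    ∑ x, f x * atPort i A x y = ∑ t, f (Function.update y i t) * A t (y i) := by
  refine (Fintype.sum_of_injective (Function.update y i) (Function.update_injective y i) _ _
    (fun x hx => ?_) fun t => ?_).symm
  · rw [atPort_apply, if_neg, mul_zero]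
    intro h
    refine hx ⟨x i, ?_⟩
    ext j
    by_cases hj : j = i
    · subst hj; simp
    · simp [hj, h j hj]
  · rw [atPort_apply, if_pos fun j hj => by simp [hj], Function.update_self]

/-- The partial trace is dual to tensoring with the identity. Through this pairing, identities
between channels become cyclicity of the trace. -/
lemma trace_tracePort_mul {c : Type*} [Fintype c] [DecidableEq c] (i : Fin N)
    (M : Matrix (c × Ports d N) (c × Ports d N) ℂ) (A : Matrix (Fin d) (Fin d) ℂ) :
    (tracePort i M * A).trace = (M * ((1 : Matrix c c ℂ) ⊗ₖ atPort i A)).trace := by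
  have h1 : (M * ((1 : Matrix c c ℂ) ⊗ₖ atPort i A)).trace =
      ∑ k, ∑ y, ∑ t, M (k, y) (k, Function.update y i t) * A t (y i) := by
    simp only [Matrix.trace, Matrix.diag_apply, Matrix.mul_apply, Fintype.sum_prod_type,
      Matrix.kronecker_apply, Matrix.one_apply, ite_mul, one_mul, zero_mul, mul_ite, mul_zero]
    refine Finset.sum_congr rfl fun k _ => Finset.sum_congr rfl fun y _ => ?_
    rw [Finset.sum_comm]
    simp only [Finset.sum_ite_eq', Finset.mem_univ, if_true]
    exact sum_atPort_mul i A y _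
  rw [h1]
  simp only [Matrix.trace, Matrix.diag_apply, Matrix.mul_apply, tracePort, Matrix.of_apply,
    Finset.sum_mul, ite_mul, zero_mul]
  rw [Finset.sum_comm_cycle]
  refine Finset.sum_congr rfl fun k _ => ?_
  rw [Finset.sum_comm_cycle]
  refine Finset.sum_congr rfl fun y _ => ?_
  rw [Finset.sum_comm]
  simp

/-! ### Permutations of the ports -/

lemma permOp_apply (ζ : Equiv.Perm (Fin N)) (x y : Ports d N) :
    permOp d ζ x y = if x ∘ ζ = y then 1 else 0 := by
  rw [permOp, Matrix.of_apply]
  refine if_congr ⟨?_, ?_⟩ rfl rfl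
  · rintro rfl; simp [Function.comp_assoc]
  · rintro rfl; simp [Function.comp_assoc]

lemma permOp_mul (ζ : Equiv.Perm (Fin N)) {c : Type*} (M : Matrix (Ports d N) c ℂ) :
    permOp d ζ * M = M.submatrix (fun x => x ∘ ζ) id := by
  ext x y
  simp [permOp_apply, Matrix.mul_apply]

lemma permOp_mul_permOp (ζ η : Equiv.Perm (Fin N)) :
    permOp d ζ * permOp d η = permOp d (ζ * η) := by
  ext x y
  rw [permOp_mul, Matrix.submatrix_apply, permOp_apply, permOp_apply]
  rfl

lemma permOp_one : permOp d (1 : Equiv.Perm (Fin N)) = 1 := by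
  ext x y
  simp [permOp_apply, Matrix.one_apply]

lemma conjTranspose_permOp (ζ : Equiv.Perm (Fin N)) : (permOp d ζ)ᴴ = permOp d ζ⁻¹ := by
  ext x y
  rw [Matrix.conjTranspose_apply, permOp_apply, permOp, Matrix.of_apply, apply_ite star, star_one,
    star_zero]
  exact if_congr eq_comm rfl rfl

lemma permOp_adjoint_mul (ζ : Equiv.Perm (Fin N)) : (permOp d ζ)ᴴ * permOp d ζ = 1 := by
  rw [conjTranspose_permOp, permOp_mul_permOp, inv_mul_cancel, permOp_one]

lemma permOp_conj (ζ : Equiv.Perm (Fin N)) (M : Matrix (Ports d N) (Ports d N) ℂ) :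
    permOp d ζ * M * (permOp d ζ)ᴴ = M.submatrix (fun x => x ∘ ζ) (fun x => x ∘ ζ) := by
  rw [permOp_mul]
  ext x y
  simp [Matrix.mul_apply, permOp_apply, apply_ite]

lemma permOp_conj_tensorFam (ζ : Equiv.Perm (Fin N)) (F : Fin N → Matrix (Fin d) (Fin d) ℂ) :
    permOp d ζ * tensorFam F * (permOp d ζ)ᴴ = tensorFam (F ∘ ζ.symm) := by
  rw [permOp_conj]
  ext x y
  simp only [tensorFam, Matrix.submatrix_apply, Matrix.of_apply, Function.comp_apply]
  exact Fintype.prod_equiv ζ _ _ fun j => by simp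

lemma permOp_mul_tensorPow (ζ : Equiv.Perm (Fin N)) (V : Matrix (Fin d) (Fin d) ℂ) :
    permOp d ζ * tensorPow N V = tensorPow N V * permOp d ζ := by
  have h := permOp_conj_tensorFam ζ (fun _ => V)
  rw [← tensorPow_eq_tensorFam] at h
  calc permOp d ζ * tensorPow N V
      = permOp d ζ * tensorPow N V * (permOp d ζ)ᴴ * permOp d ζ := by
        rw [mul_assoc _ _ (permOp d ζ), permOp_adjoint_mul, mul_one]
    _ = tensorPow N V * permOp d ζ := by rw [h]; rfl

lemma permOp_conj_atPort (ζ : Equiv.Perm (Fin N)) (i : Fin N) (A : Matrix (Fin d) (Fin d) ℂ) :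
    (permOp d ζ)ᴴ * atPort (ζ i) A * permOp d ζ = atPort i A := by
  have h := permOp_conj_tensorFam ζ⁻¹ (Function.update (fun _ => 1) (ζ i) A)
  rw [← conjTranspose_permOp, Matrix.conjTranspose_conjTranspose] at h
  rw [atPort, h, atPort]
  congr 1
  ext j : 1
  by_cases hj : j = i
  · subst hj
    change Function.update _ _ _ (ζ j) = _
    simp
  · change Function.update _ _ _ (ζ j) = _
    simp [hj]

end TensorFamilies

/-! ### Protocols as families of Choi operators on A₀B^N. -/

section Protocols

variable {d N : ℕ} {a : Type*} [Fintype a] [DecidableEq a]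

/-- The Choi operator of the map from Alice's input to Bob's ports that one effect `E` induces. -/
def effectChoi (ρ : Matrix (a × Ports d N) (a × Ports d N) ℂ)
    (E : Matrix (Fin d × a) (Fin d × a) ℂ) : Matrix (Fin d × Ports d N) (Fin d × Ports d N) ℂ :=
  Matrix.of fun p q => ∑ k, ∑ k', E (q.1, k) (p.1, k') * ρ (k', p.2) (k, q.2)

/-- The operator arises from the positive operator Eᵀ ⊗ ρ by contracting the two copies of Alice's
system, and this contraction has the form T(·)T†. -/
lemma effectChoi_posSemidef {ρ : Matrix (a × Ports d N) (a × Ports d N) ℂ}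
    {E : Matrix (Fin d × a) (Fin d × a) ℂ} (hρ : ρ.PosSemidef) (hE : E.PosSemidef) :
    (effectChoi ρ E).PosSemidef := by
  have hk : (Eᵀ ⊗ₖ ρ).PosSemidef := hE.transpose.kronecker hρ
  have h := hk.mul_mul_conjTranspose_same
    (Matrix.of fun (p : Fin d × Ports d N) (q : (Fin d × a) × (a × Ports d N)) =>
      if q.1.1 = p.1 then if q.2.2 = p.2 then if q.1.2 = q.2.1 then (1 : ℂ) else 0 else 0 else 0)
  convert h using 1
  ext p q
  simp [effectChoi, Matrix.mul_apply, Fintype.sum_prod_type, apply_ite]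

lemma sum_effectChoi {ρ : Matrix (a × Ports d N) (a × Ports d N) ℂ} {ι : Type*} [Fintype ι]
    {E : ι → Matrix (Fin d × a) (Fin d × a) ℂ} (hE : ∑ i, E i = 1) :
    ∑ i, effectChoi ρ (E i) = (1 : Matrix (Fin d) (Fin d) ℂ) ⊗ₖ bobMarginal ρ := by
  ext ⟨k, y⟩ ⟨l, y'⟩
  have h (p q : Fin d × a) : ∑ i, E i p q = (1 : Matrix (Fin d × a) (Fin d × a) ℂ) p q := by
    rw [← hE, Matrix.sum_apply]
  simp only [effectChoi, Matrix.sum_apply, Matrix.of_apply]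
  rw [Finset.sum_comm.trans (Finset.sum_congr rfl fun k _ => Finset.sum_comm)]
  simp only [← Finset.sum_mul, h, Matrix.one_apply, Prod.mk.injEq, bobMarginal,
    Matrix.kronecker_apply, Matrix.of_apply]
  by_cases hk : k = l
  · simp [hk]
  · simp [hk, Ne.symm hk]

/-- The map from `A₀` to `B₀` whose Choi operator is `∑ i, tr_{B_i^c} (C i)`. -/
noncomputable def portChannel : (Fin N → Matrix (Fin d × Ports d N) (Fin d × Ports d N) ℂ) →ₗ[ℂ]
    Matrix (Fin d) (Fin d) ℂ →ₗ[ℂ] Matrix (Fin d) (Fin d) ℂ :=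
  LinearMap.mk₂ ℂ (fun C X => Matrix.of fun s t =>
      ∑ i, (C i * (Xᵀ ⊗ₖ atPort i (Matrix.single t s 1))).trace)
    (fun C C' X => by ext s t; simp [add_mul, Finset.sum_add_distrib])
    (fun c C X => by ext s t; simp [Finset.mul_sum])
    (fun C X Y => by ext s t; simp [Matrix.add_kronecker, mul_add, Finset.sum_add_distrib])
    (fun c C X => by ext s t; simp [Matrix.smul_kronecker, Finset.mul_sum])

lemma trace_portChannel_mul (C : Fin N → Matrix (Fin d × Ports d N) (Fin d × Ports d N) ℂ)
    (X A : Matrix (Fin d) (Fin d) ℂ) :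
    (portChannel C X * A).trace = ∑ i, (C i * (Xᵀ ⊗ₖ atPort i A)).trace := by
  let φ : Matrix (Fin d) (Fin d) ℂ →ₗ[ℂ] ℂ :=
    { toFun := fun A => ∑ i, (C i * (Xᵀ ⊗ₖ atPort i A)).trace
      map_add' := fun A B => by
        simp [atPort_add, Matrix.kronecker_add, mul_add, Finset.sum_add_distrib]
      map_smul' := fun c A => by simp [atPort_smul, Matrix.kronecker_smul, Finset.mul_sum] }
  let χ : Matrix (Fin d) (Fin d) ℂ →ₗ[ℂ] ℂ :=
    { toFun := fun A => (portChannel C X * A).trace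
      map_add' := fun A B => by simp [mul_add]
      map_smul' := fun c A => by simp }
  have : χ = φ := by
    refine Matrix.ext_linearMap ℂ fun t s => LinearMap.ext_ring ?_
    change (portChannel C X * Matrix.single t s 1).trace = _
    rw [Matrix.trace_mul_single]
    simp [portChannel, φ]
  exact LinearMap.congr_fun this A

lemma ext_trace {M M' : Matrix (Fin d) (Fin d) ℂ} (h : ∀ A, (M * A).trace = (M' * A).trace) :
    M = M' := by
  ext s t
  simpa [Matrix.trace_mul_single] using h (Matrix.single t s 1)

lemma Protocol.channel_eq (P : Protocol d N a) :
    P.channel = portChannel fun i => effectChoi P.state (P.povm i) := by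
  refine LinearMap.ext fun X => ext_trace fun A => ?_
  rw [trace_portChannel_mul]
  have : P.channel X * A = ∑ i, tracePort i
    ((P.povm i ⊗ₖ (1 : Matrix (Ports d N) (Ports d N) ℂ)) * inputWithResource X P.state) * A :=
      Finset.sum_mul _ _ _
  rw [this, Matrix.trace_sum]
  refine Finset.sum_congr rfl fun i _ => ?_
  rw [trace_tracePort_mul]
  generalize atPort i A = O
  simp only [Matrix.trace, Matrix.diag_apply, Matrix.mul_apply, Fintype.sum_prod_type,
    Matrix.kronecker_apply, Matrix.one_apply, inputWithResource, Matrix.submatrix_apply,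
    effectChoi, Matrix.of_apply, Equiv.prodAssoc_apply, Matrix.transpose_apply]
  simp only [Prod.mk.injEq, ite_and, ite_mul, mul_ite, one_mul, mul_one, zero_mul, mul_zero,
    Finset.sum_ite_eq, Finset.sum_ite_eq', Finset.mem_univ, if_true, Finset.sum_mul,
    Finset.sum_ite_irrel, Finset.sum_const_zero]
  simp only [← Fintype.sum_prod_type']
  -- Both sides are now the same six-fold sum, up to the order of the summation variables.
  let e : Fin d × a × Ports d N × Ports d N × Fin d × a ≃
      Fin d × Ports d N × Fin d × Ports d N × a × a :=
    { toFun := fun x => (x.2.2.2.2.1, x.2.2.1, x.1, x.2.2.2.1, x.2.1, x.2.2.2.2.2)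
      invFun := fun x => (x.2.2.1, x.2.2.2.2.1, x.2.1, x.2.2.2.1, x.1, x.2.2.2.2.2)
      left_inv := fun _ => rfl
      right_inv := fun _ => rfl }
  refine Fintype.sum_equiv e _ _ fun x => ?_
  dsimp only [e, Equiv.coe_fn_mk]
  ring

lemma portChannel_single_apply
    (C : Fin N → Matrix (Fin d × Ports d N) (Fin d × Ports d N) ℂ) (k l s t : Fin d) :
    portChannel C (Matrix.single k l 1) s t =
      ∑ i, ∑ y : Ports d N, if y i = s then C i (k, y) (l, Function.update y i t) else 0 := by
  have h : portChannel C (Matrix.single k l 1) s t =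
      ∑ i, (C i * ((Matrix.single k l 1)ᵀ ⊗ₖ atPort i (Matrix.single t s 1))).trace := rfl
  rw [h]
  refine Finset.sum_congr rfl fun i _ => ?_
  have h2 : (C i * ((Matrix.single k l 1)ᵀ ⊗ₖ atPort i (Matrix.single t s 1))).trace =
      ∑ y, ∑ y', C i (k, y) (l, y') * atPort i (Matrix.single t s 1) y' y := by
    simp only [Matrix.trace, Matrix.diag_apply, Matrix.mul_apply, Fintype.sum_prod_type,
      Matrix.kronecker_apply, Matrix.transpose_apply, Matrix.single, Matrix.of_apply]
    rw [Finset.sum_eq_single k (fun j _ hj => by simp [Ne.symm hj]) (by simp)]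
    refine Finset.sum_congr rfl fun y _ => ?_
    rw [Finset.sum_eq_single l (fun j _ hj => by simp [Ne.symm hj]) (by simp)]
    simp
  rw [h2]
  refine Finset.sum_congr rfl fun y _ => ?_
  rw [sum_atPort_mul i _ y fun y' => C i (k, y) (l, y')]
  simp [Matrix.single, ite_and, eq_comm]

/-- The value of y at port i is overwritten, so fixing it to be s₀ lists each configuration of the
other ports once. This displays the Choi operator as a sum of principal compressions of the C i,
hence its positivity. -/
lemma choi_portChannel (C : Fin N → Matrix (Fin d × Ports d N) (Fin d × Ports d N) ℂ)
    (s₀ : Fin d) :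
    choi (portChannel C) = ∑ i, ∑ y : Ports d N with y i = s₀,
      (C i).submatrix (fun p => (p.1, Function.update y i p.2))
        (fun p => (p.1, Function.update y i p.2)) := by
  ext ⟨k, s⟩ ⟨l, t⟩
  simp only [choi, Matrix.of_apply, portChannel_single_apply, Matrix.sum_apply,
    Matrix.submatrix_apply]
  refine Finset.sum_congr rfl fun i _ => ?_
  rw [← Finset.sum_filter]
  refine Finset.sum_nbij' (fun y => Function.update y i s₀) (fun y => Function.update y i s)
    ?_ ?_ ?_ ?_ ?_
  · simp
  · simp
  · rintro y hy
    simp [← (Finset.mem_filter.1 hy).2]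
  · rintro y hy
    simp [← (Finset.mem_filter.1 hy).2]
  · rintro y hy
    simp [← (Finset.mem_filter.1 hy).2]

lemma isCP_portChannel {C : Fin N → Matrix (Fin d × Ports d N) (Fin d × Ports d N) ℂ}
    (hC : ∀ i, (C i).PosSemidef) : IsCP (portChannel C) := by
  apply isCP_of_choi
  rcases isEmpty_or_nonempty (Fin d) with h | ⟨⟨s₀⟩⟩
  · rw [Subsingleton.elim (choi (portChannel C)) 0]
    exact .zero
  · rw [choi_portChannel C s₀]
    exact Matrix.posSemidef_sum _ fun i _ => Matrix.posSemidef_sum _ fun y _ => (hC i).submatrix _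

lemma trace_portChannel {C : Fin N → Matrix (Fin d × Ports d N) (Fin d × Ports d N) ℂ}
    {σ : Matrix (Ports d N) (Ports d N) ℂ} (hσ : σ.trace = 1)
    (hC : ∑ i, C i = (1 : Matrix (Fin d) (Fin d) ℂ) ⊗ₖ σ) (X : Matrix (Fin d) (Fin d) ℂ) :
    (portChannel C X).trace = X.trace := by
  have := trace_portChannel_mul C X 1
  rw [mul_one] at this
  rw [this]
  simp only [atPort_one]
  rw [← Matrix.trace_sum, ← Finset.sum_mul, hC, ← Matrix.mul_kronecker_mul, one_mul, mul_one,
    Matrix.trace_kronecker, hσ, mul_one, Matrix.trace_transpose]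

lemma trace_bobMarginal (ρ : Matrix (a × Ports d N) (a × Ports d N) ℂ) :
    (bobMarginal ρ).trace = ρ.trace := by
  simp only [Matrix.trace, Matrix.diag_apply, bobMarginal, Matrix.of_apply, Fintype.sum_prod_type]
  exact Finset.sum_comm

lemma bobMarginal_posSemidef {ρ : Matrix (a × Ports d N) (a × Ports d N) ℂ} (h : ρ.PosSemidef) :
    (bobMarginal ρ).PosSemidef := by
  have : bobMarginal ρ = ∑ k, ρ.submatrix (fun x => (k, x)) fun x => (k, x) := by
    ext x y
    simp [bobMarginal, Matrix.sum_apply]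
  rw [this]
  exact Matrix.posSemidef_sum _ fun k _ => h.submatrix _

lemma Protocol.sum_effectChoi (P : Protocol d N a) :
    ∑ i, effectChoi P.state (P.povm i) = (1 : Matrix (Fin d) (Fin d) ℂ) ⊗ₖ bobMarginal P.state :=
  PBT.sum_effectChoi P.isPOVM.2

lemma Protocol.isChannel (P : Protocol d N a) : IsChannel P.channel := by
  rw [P.channel_eq]
  exact ⟨isCP_portChannel fun i => effectChoi_posSemidef P.isState.1 (P.isPOVM.1 i),
    trace_portChannel ((trace_bobMarginal _).trans P.isState.2) P.sum_effectChoi⟩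

/-! ### Pure resource states -/

/-- The operator from Alice's to Bob's system with the coefficients of `ψ`. -/
def coeffMat (ψ : a × Ports d N → ℂ) : Matrix (Ports d N) a ℂ := Matrix.of fun y k => ψ (k, y)

lemma effectChoi_proj (ψ : a × Ports d N → ℂ) (E : Matrix (Fin d × a) (Fin d × a) ℂ) :
    effectChoi (proj ψ) E = ((1 : Matrix (Fin d) (Fin d) ℂ) ⊗ₖ coeffMat ψ) * Eᵀ *
      ((1 : Matrix (Fin d) (Fin d) ℂ) ⊗ₖ coeffMat ψ)ᴴ := by
  ext ⟨k, y⟩ ⟨l, y'⟩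
  simp only [effectChoi, Matrix.mul_apply, Fintype.sum_prod_type, Matrix.of_apply, coeffMat,
    Matrix.conjTranspose_apply, Matrix.kronecker_apply, Matrix.transpose_apply, proj,
    Matrix.vecMulVec_apply, Matrix.one_apply, Pi.star_apply]
  rw [Finset.sum_eq_single l (fun j _ hj => by simp [Ne.symm hj]) (by simp)]
  refine Finset.sum_congr rfl fun x _ => ?_
  rw [Finset.sum_eq_single k (fun j _ hj => by simp [Ne.symm hj]) (by simp), Finset.sum_mul]
  refine Finset.sum_congr rfl fun x' _ => ?_
  simp
  ring

lemma bobMarginal_proj (ψ : a × Ports d N → ℂ) :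
    bobMarginal (proj ψ) = coeffMat ψ * (coeffMat ψ)ᴴ := by
  ext x y
  simp [bobMarginal, proj, Matrix.vecMulVec_apply, coeffMat, Matrix.mul_apply]

/-- The canonical purification of a state of the ports. -/
noncomputable def purification (σ : Matrix (Ports d N) (Ports d N) ℂ) :
    Ports d N × Ports d N → ℂ := fun p => opSqrt σ p.2 p.1

lemma coeffMat_purification (σ : Matrix (Ports d N) (Ports d N) ℂ) :
    coeffMat (purification σ) = opSqrt σ := rfl

lemma bobMarginal_purification {σ : Matrix (Ports d N) (Ports d N) ℂ} (hσ : σ.PosSemidef) :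
    bobMarginal (proj (purification σ)) = σ := by
  rw [bobMarginal_proj, coeffMat_purification, conjTranspose_opSqrt, opSqrt_mul_opSqrt hσ]

lemma mul_eq_zero_of_adjoint_mul_mul {n : Type*} [Fintype n] [DecidableEq n] {C Q : Matrix n n ℂ}
    (hC : C.PosSemidef) (h : Qᴴ * C * Q = 0) : C * Q = 0 := by
  have h1 : (opSqrt C * Q)ᴴ * (opSqrt C * Q) = 0 := by
    rw [Matrix.conjTranspose_mul, conjTranspose_opSqrt, mul_assoc, ← mul_assoc (opSqrt C),
      opSqrt_mul_opSqrt hC, ← mul_assoc, h]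
  rw [← opSqrt_mul_opSqrt hC, mul_assoc, Matrix.conjTranspose_mul_self_eq_zero.1 h1, mul_zero]

/-- The positive operators Q†C_jQ have traces that add up to zero, so each of them vanishes. -/
lemma mul_eq_zero_of_sum_mul {n ι : Type*} [Fintype n] [DecidableEq n] [Fintype ι]
    {C : ι → Matrix n n ℂ} {Q : Matrix n n ℂ} (hC : ∀ i, (C i).PosSemidef)
    (h : (∑ i, C i) * Q = 0) (i : ι) : C i * Q = 0 := by
  have hp (j : ι) : (Qᴴ * C j * Q).PosSemidef := (hC j).conjTranspose_mul_mul_same Q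
  have h1 : ∑ j, (Qᴴ * C j * Q).trace = 0 := by
    rw [← Matrix.trace_sum, ← Finset.sum_mul, ← Finset.mul_sum, mul_assoc, h, mul_zero,
      Matrix.trace_zero]
  have h2 := (Finset.sum_eq_zero_iff_of_nonneg fun j _ => (hp j).trace_nonneg).1 h1 i
    (Finset.mem_univ i)
  exact mul_eq_zero_of_adjoint_mul_mul (hC i) ((hp i).trace_eq_zero_iff.1 h2)

/-- Every family of positive operators on `A₀ B^N` that sums to `1 ⊗ σ` comes from measuring
Alice's half of the canonical purification of `σ`. -/
lemma exists_protocol_effectChoi_eq (hN : 0 < N)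
    {C : Fin N → Matrix (Fin d × Ports d N) (Fin d × Ports d N) ℂ}
    (hC : ∀ i, (C i).PosSemidef) {σ : Matrix (Ports d N) (Ports d N) ℂ} (hσ : IsState σ)
    (hCσ : ∑ i, C i = (1 : Matrix (Fin d) (Fin d) ℂ) ⊗ₖ σ) :
    ∃ P : Protocol d N (Ports d N), P.state = proj (purification σ) ∧
      ∀ i, effectChoi P.state (P.povm i) = C i := by
  set I : Matrix (Fin d) (Fin d) ℂ := 1 with hI
  set Q := 1 - supp σ with hQ
  have hQh : Qᴴ = Q := by rw [hQ, Matrix.conjTranspose_sub, conjTranspose_supp,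
    Matrix.conjTranspose_one]
  have hQQ : Q * Q = Q := by
    rw [hQ, mul_sub, sub_mul, sub_mul, supp_mul_supp]; simp
  have hsQ : opSqrt σ * Q = 0 := by rw [hQ, mul_sub, opSqrt_mul_supp hσ.1, mul_one, sub_self]
  have hII : Iᴴ = I := Matrix.conjTranspose_one
  -- Conjugating C i with the pseudo-inverse root of σ gives operators that sum to 1 ⊗ supp σ. The
  -- missing projection 1 ⊗ Q is shared equally among the N outcomes; √σ annihilates it, so it does
  -- not affect the induced maps.
  set D : Fin N → Matrix (Fin d × Ports d N) (Fin d × Ports d N) ℂ := fun i =>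
    (I ⊗ₖ opSqrtInv σ) * C i * (I ⊗ₖ opSqrtInv σ)ᴴ + (N : ℂ)⁻¹ • (I ⊗ₖ Q) with hD
  have hDp (i : Fin N) : (D i).PosSemidef := by
    refine ((hC i).mul_mul_conjTranspose_same _).add (Matrix.PosSemidef.smul ?_ (by positivity))
    have := Matrix.posSemidef_self_mul_conjTranspose (I ⊗ₖ Q)
    rwa [Matrix.conjTranspose_kronecker, hII, hQh, ← Matrix.mul_kronecker_mul, hQQ, hI, one_mul]
      at this
  have hDs : ∑ i, D i = 1 := by
    have hN' : (N : ℂ) ≠ 0 := by exact_mod_cast hN.ne'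
    simp only [hD, Finset.sum_add_distrib, ← Finset.sum_mul, ← Finset.mul_sum, hCσ,
      Finset.sum_const, Finset.card_univ, Fintype.card_fin]
    rw [Matrix.conjTranspose_kronecker, conjTranspose_opSqrtInv, hII, ← Matrix.mul_kronecker_mul,
      ← Matrix.mul_kronecker_mul, opSqrtInv_mul_self_mul hσ.1, ← Nat.cast_smul_eq_nsmul ℂ,
      smul_smul, mul_inv_cancel₀ hN', one_smul, hI, one_mul, one_mul, ← Matrix.kronecker_add, hQ,
      add_sub_cancel, Matrix.one_kronecker_one]
  -- Undoing the conjugation leaves C i compressed to the support of σ; since C i is dominated by 1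
  -- ⊗ σ, it already lives there.
  have hkey (i : Fin N) : (I ⊗ₖ opSqrt σ) * D i * (I ⊗ₖ opSqrt σ)ᴴ = C i := by
    have h1 : C i * (I ⊗ₖ Q) = 0 := mul_eq_zero_of_sum_mul hC (by
      rw [hCσ, ← Matrix.mul_kronecker_mul, hQ, mul_sub σ, self_mul_supp hσ.1, mul_one, mul_one,
        sub_self,
        Matrix.kronecker_zero]) i
    have h2 : C i * (I ⊗ₖ supp σ) = C i := by
      have : I ⊗ₖ supp σ = 1 - I ⊗ₖ Q := by
        rw [eq_sub_iff_add_eq, ← Matrix.kronecker_add, hQ, add_sub_cancel, hI,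
          Matrix.one_kronecker_one]
      rw [this, mul_sub, h1, mul_one, sub_zero]
    have h3 : (I ⊗ₖ supp σ) * C i = C i := by
      have := congrArg Matrix.conjTranspose h2
      rwa [Matrix.conjTranspose_mul, Matrix.conjTranspose_kronecker, hII, conjTranspose_supp,
        (hC i).1.eq] at this
    rw [Matrix.conjTranspose_kronecker, hII, conjTranspose_opSqrt, hD]
    dsimp only
    rw [mul_add, add_mul, mul_smul_comm, ← Matrix.mul_kronecker_mul, hsQ, Matrix.kronecker_zero,
      smul_zero, zero_mul, add_zero, Matrix.conjTranspose_kronecker, hII, conjTranspose_opSqrtInv]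
    calc I ⊗ₖ opSqrt σ * (I ⊗ₖ opSqrtInv σ * C i * I ⊗ₖ opSqrtInv σ) * I ⊗ₖ opSqrt σ
        = (I ⊗ₖ opSqrt σ * I ⊗ₖ opSqrtInv σ) * C i * (I ⊗ₖ opSqrtInv σ * I ⊗ₖ opSqrt σ) := by
          simp only [mul_assoc]
      _ = C i := by
          rw [← Matrix.mul_kronecker_mul, ← Matrix.mul_kronecker_mul, opSqrt_mul_opSqrtInv hσ.1,
            opSqrtInv_mul_opSqrt hσ.1, hI, one_mul, ← hI, h3, h2]
  -- The transpose cancels the one in `effectChoi_proj`.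
  refine ⟨⟨proj (purification σ), fun i => (D i)ᵀ, ⟨proj_posSemidef _, ?_⟩,
    fun i => (hDp i).transpose, ?_⟩, rfl, fun i => ?_⟩
  · rw [← trace_bobMarginal, bobMarginal_purification hσ.1, hσ.2]
  · rw [← Matrix.transpose_sum, hDs, Matrix.transpose_one]
  · dsimp only
    rw [effectChoi_proj, coeffMat_purification, Matrix.transpose_transpose, hkey]

end Protocols

/-! ### Fixed points in convex hulls of compact orbits. -/

section Averaging

variable {V : Type*} [AddCommGroup V] [Module ℝ V] [TopologicalSpace V] [ContinuousAdd V]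
  [ContinuousSMul ℝ V] [FiniteDimensional ℝ V]

/-- By Carathéodory's theorem the convex hull of a compact set in finite dimension is compact. -/
lemma isCompact_convexHull {s : Set V} (hs : IsCompact s) : IsCompact (convexHull ℝ s) := by
  rcases s.eq_empty_or_nonempty with rfl | ⟨x₀, hx₀⟩
  · simp
  let n := Module.finrank ℝ V + 1
  have hK : IsCompact (stdSimplex ℝ (Fin n) ×ˢ Set.pi Set.univ fun _ : Fin n => s) :=
    (isCompact_stdSimplex ℝ (Fin n)).prod (isCompact_univ_pi fun _ => hs)
  have hc : Continuous fun p : (Fin n → ℝ) × (Fin n → V) => ∑ i, p.1 i • p.2 i := by fun_prop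
  convert hK.image hc using 1
  ext x
  constructor
  · intro hx
    -- The points are affinely independent, so there are at most n of them; the list is padded to
    -- length n with weight 0 and the point x₀.
    obtain ⟨ι, _, z, w, hz, hzi, hw, hw1, rfl⟩ := eq_pos_convex_span_of_mem_convexHull hx
    have hcard : Fintype.card ι ≤ Fintype.card (Fin n) := by
      rw [Fintype.card_fin]
      exact hzi.card_le_finrank_succ.trans (Nat.succ_le_succ (Submodule.finrank_le _))
    obtain ⟨e⟩ := Function.Embedding.nonempty_of_card_le hcard
    have hwe (i : ι) : Function.extend e w 0 (e i) = w i := e.injective.extend_apply _ _ _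
    have hze (i : ι) : Function.extend e z (fun _ => x₀) (e i) = z i :=
      e.injective.extend_apply _ _ _
    have hw0 (j : Fin n) (hj : j ∉ Set.range e) : Function.extend e w 0 j = 0 :=
      Function.extend_apply' _ _ _ hj
    refine ⟨(Function.extend e w 0, Function.extend e z fun _ => x₀),
      ⟨⟨fun j => ?_, ?_⟩, fun j _ => ?_⟩, ?_⟩
    · dsimp only
      by_cases hj : j ∈ Set.range e
      · obtain ⟨i, rfl⟩ := hj
        rw [hwe]
        exact (hw i).le
      · rw [hw0 j hj]
    · rw [← hw1]
      exact (Fintype.sum_of_injective e e.injective _ _ hw0 fun i => (hwe i).symm).symm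
    · dsimp only
      by_cases hj : j ∈ Set.range e
      · obtain ⟨i, rfl⟩ := hj
        rw [hze]
        exact hz ⟨i, rfl⟩
      · rwa [Function.extend_apply' _ _ _ hj]
    · refine (Fintype.sum_of_injective e e.injective _ _ (fun j hj => ?_) fun i => ?_).symm
      · dsimp only
        rw [hw0 j hj, zero_smul]
      · dsimp only
        rw [hwe, hze]
  · rintro ⟨⟨w, z⟩, ⟨⟨hw, hw1⟩, hz⟩, rfl⟩
    exact (convex_convexHull ℝ s).sum_mem (fun i _ => hw i) hw1
      fun i _ => subset_convexHull ℝ s (hz i trivial)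

/-- Linear maps that permute a compact set and preserve a strictly convex function have a common
fixed point in its convex hull. -/
lemma exists_fixed_mem_convexHull {s : Set V} (hs : IsCompact s) (hne : s.Nonempty) {q : V → ℝ}
    (hq : StrictConvexOn ℝ Set.univ q) (hqc : Continuous q) {G : Type*} (T : G → V →ₗ[ℝ] V)
    (hT : ∀ g, Set.MapsTo (T g) s s) (hTq : ∀ g x, q (T g x) = q x) :
    ∃ y ∈ convexHull ℝ s, ∀ g, T g y = y := by
  obtain ⟨y, hy, hmin⟩ := (isCompact_convexHull hs).exists_isMinOn hne.convexHull hqc.continuousOn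
  refine ⟨y, hy, fun g => ?_⟩
  have hgy : T g y ∈ convexHull ℝ s := by
    have : T g y ∈ T g '' convexHull ℝ s := ⟨y, hy, rfl⟩
    rw [(T g).image_convexHull] at this
    exact convexHull_mono (hT g).image_subset this
  refine (hq.subset (Set.subset_univ _) (convex_convexHull ℝ s)).eq_of_isMinOn (fun z hz => ?_)
    hmin hgy hy
  change q (T g y) ≤ q z
  rw [hTq]
  exact hmin hz

end Averaging

/-! ### The squared Hilbert-Schmidt norm as a strictly convex function. -/

section HilbertSchmidt

variable {ι n : Type*} [Fintype ι] [Fintype n]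

/-- The square of the Hilbert-Schmidt norm of a family of operators. -/
noncomputable def hsNormSq (C : ι → Matrix n n ℂ) : ℝ := ∑ i, (C i * (C i)ᴴ).trace.re

lemma hsNormSq_eq (C : ι → Matrix n n ℂ) :
    hsNormSq C = ∑ i, ∑ x, ∑ y, Complex.normSq (C i x y) := by
  simp [hsNormSq, Matrix.trace, Matrix.mul_apply, Complex.normSq_apply]

lemma continuous_hsNormSq : Continuous (hsNormSq : (ι → Matrix n n ℂ) → ℝ) := by
  have : (hsNormSq : (ι → Matrix n n ℂ) → ℝ) =
    fun C => ∑ i, ∑ x, ∑ y, Complex.normSq (C i x y) := funext hsNormSq_eq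
  rw [this]
  have h (i x y) : Continuous fun C : ι → Matrix n n ℂ => C i x y := by fun_prop
  exact continuous_finsetSum _ fun i _ => continuous_finsetSum _ fun x _ =>
    continuous_finsetSum _ fun y _ => Complex.continuous_normSq.comp (h i x y)

lemma hsNormSq_pos {C : ι → Matrix n n ℂ} (hC : C ≠ 0) : 0 < hsNormSq C := by
  rw [hsNormSq_eq]
  obtain ⟨i, hi⟩ := Function.ne_iff.1 hC
  obtain ⟨x, y, hxy⟩ : ∃ x y, C i x y ≠ 0 := by
    by_contra! h
    exact hi (Matrix.ext h)
  refine Finset.sum_pos' (fun i _ => Finset.sum_nonneg fun x _ => Finset.sum_nonneg fun y _ =>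
    Complex.normSq_nonneg _) ⟨i, Finset.mem_univ i, ?_⟩
  refine Finset.sum_pos' (fun x _ => Finset.sum_nonneg fun y _ =>
    Complex.normSq_nonneg _) ⟨x, Finset.mem_univ x, ?_⟩
  exact Finset.sum_pos' (fun y _ => Complex.normSq_nonneg _)
    ⟨y, Finset.mem_univ y, Complex.normSq_pos.2 hxy⟩

/-- For weights s + t = 1, the convexity defect is exactly s·t·‖C - D‖². -/
lemma strictConvexOn_hsNormSq :
    StrictConvexOn ℝ Set.univ (hsNormSq : (ι → Matrix n n ℂ) → ℝ) := by
  refine ⟨convex_univ, fun C _ D _ hCD s t hs ht hst => ?_⟩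
  have h : hsNormSq (s • C + t • D) = s * hsNormSq C + t * hsNormSq D -
      s * t * hsNormSq (C - D) := by
    simp only [hsNormSq_eq, Finset.mul_sum, ← Finset.sum_add_distrib, ← Finset.sum_sub_distrib]
    refine Finset.sum_congr rfl fun i _ => Finset.sum_congr rfl fun x _ =>
      Finset.sum_congr rfl fun y _ => ?_
    obtain rfl : t = 1 - s := by linarith
    simp [Complex.normSq_apply]
    ring
  have := mul_pos (mul_pos hs ht) (hsNormSq_pos (sub_ne_zero.2 hCD))
  rw [h, smul_eq_mul, smul_eq_mul]
  linarith

end HilbertSchmidt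

/-! ### The action of U(d) × S_N on Choi operators and POVMs, and its averages. -/

section Symmetrization

variable {d N : ℕ}

lemma conjMat_mul (A B : Matrix (Fin d) (Fin d) ℂ) :
    conjMat (A * B) = conjMat A * conjMat B :=
  Matrix.map_mul (f := starRingEnd ℂ)

lemma conjMat_conjTranspose (A : Matrix (Fin d) (Fin d) ℂ) : conjMat Aᴴ = (conjMat A)ᴴ := rfl

lemma conjMat_one : conjMat (1 : Matrix (Fin d) (Fin d) ℂ) = 1 :=
  Matrix.map_one _ (map_zero (starRingEnd ℂ)) (map_one (starRingEnd ℂ))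

/-- The entrywise complex conjugate of a unitary. -/
def conjUnitary (U : Matrix.unitaryGroup (Fin d) ℂ) : Matrix.unitaryGroup (Fin d) ℂ :=
  ⟨conjMat (U : Matrix (Fin d) (Fin d) ℂ), by
    rw [Matrix.mem_unitaryGroup_iff, Matrix.star_eq_conjTranspose, ← conjMat_conjTranspose,
      ← conjMat_mul, unitary_mul_adjoint, conjMat_one]⟩

lemma conjUnitary_conjUnitary (U : Matrix.unitaryGroup (Fin d) ℂ) :
    conjUnitary (conjUnitary U) = U := by
  ext i j
  simp [conjUnitary, conjMat]

/-- The operator by which `(U, ζ)` acts on `A₀ A^N`. -/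
noncomputable def symOp (U : Matrix.unitaryGroup (Fin d) ℂ) (ζ : Equiv.Perm (Fin N)) :
    Matrix (Fin d × Ports d N) (Fin d × Ports d N) ℂ :=
  (U : Matrix (Fin d) (Fin d) ℂ) ⊗ₖ
    (tensorPow N (conjUnitary U : Matrix (Fin d) (Fin d) ℂ) * permOp d ζ)

lemma symOp_mul (U U' : Matrix.unitaryGroup (Fin d) ℂ) (ζ ζ' : Equiv.Perm (Fin N)) :
    symOp U ζ * symOp U' ζ' = symOp (U * U') (ζ * ζ') := by
  rw [symOp, symOp, symOp, ← Matrix.mul_kronecker_mul]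
  congr 1
  have h : (conjUnitary (U * U') : Matrix (Fin d) (Fin d) ℂ) =
      (conjUnitary U : Matrix (Fin d) (Fin d) ℂ) * (conjUnitary U' : Matrix (Fin d) (Fin d) ℂ) :=
    conjMat_mul _ _
  rw [h, ← tensorPow_mul, ← permOp_mul_permOp, mul_assoc, ← mul_assoc (permOp d ζ),
    permOp_mul_tensorPow, mul_assoc, mul_assoc]

lemma symOp_adjoint_mul (U : Matrix.unitaryGroup (Fin d) ℂ) (ζ : Equiv.Perm (Fin N)) :
    (symOp U ζ)ᴴ * symOp U ζ = 1 := by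
  rw [symOp, Matrix.conjTranspose_kronecker, ← Matrix.mul_kronecker_mul, unitary_adjoint_mul,
    Matrix.conjTranspose_mul, mul_assoc, ← mul_assoc (tensorPow N _)ᴴ, conjTranspose_tensorPow,
    tensorPow_mul, unitary_adjoint_mul, tensorPow_one, one_mul, permOp_adjoint_mul,
    Matrix.one_kronecker_one]

lemma symOp_mul_adjoint (U : Matrix.unitaryGroup (Fin d) ℂ) (ζ : Equiv.Perm (Fin N)) :
    symOp U ζ * (symOp U ζ)ᴴ = 1 := mul_eq_one_comm.1 (symOp_adjoint_mul U ζ)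

/-- The action of `U(d) × S_N` on families of operators on `A₀ A^N` indexed by the ports. -/
noncomputable def symAct (g : Matrix.unitaryGroup (Fin d) ℂ × Equiv.Perm (Fin N)) :
    (Fin N → Matrix (Fin d × Ports d N) (Fin d × Ports d N) ℂ) →ₗ[ℂ]
      Fin N → Matrix (Fin d × Ports d N) (Fin d × Ports d N) ℂ where
  toFun C i := symOp g.1 g.2 * C (g.2.symm i) * (symOp g.1 g.2)ᴴ
  map_add' C D := by ext1 i; simp [mul_add, add_mul]
  map_smul' c C := by ext1 i; simp

lemma symAct_apply (g : Matrix.unitaryGroup (Fin d) ℂ × Equiv.Perm (Fin N))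
    (C : Fin N → Matrix (Fin d × Ports d N) (Fin d × Ports d N) ℂ) (i : Fin N) :
    symAct g C i = symOp g.1 g.2 * C (g.2.symm i) * (symOp g.1 g.2)ᴴ := rfl

lemma symAct_mul (g h : Matrix.unitaryGroup (Fin d) ℂ × Equiv.Perm (Fin N))
    (C : Fin N → Matrix (Fin d × Ports d N) (Fin d × Ports d N) ℂ) :
    symAct g (symAct h C) = symAct (g * h) C := by
  ext1 i
  simp only [symAct_apply, Prod.fst_mul, Prod.snd_mul, ← symOp_mul, Matrix.conjTranspose_mul,
    mul_assoc]
  rfl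

lemma hsNormSq_symAct (g : Matrix.unitaryGroup (Fin d) ℂ × Equiv.Perm (Fin N))
    (C : Fin N → Matrix (Fin d × Ports d N) (Fin d × Ports d N) ℂ) :
    hsNormSq (symAct g C) = hsNormSq C := by
  refine Fintype.sum_equiv g.2.symm _ _ fun i => ?_
  set W := symOp g.1 g.2 with hW
  have h : symAct g C i * (symAct g C i)ᴴ = W * (C (g.2.symm i) * (C (g.2.symm i))ᴴ) * Wᴴ := by
    rw [symAct_apply, ← hW]
    simp only [Matrix.conjTranspose_mul, Matrix.conjTranspose_conjTranspose]
    calc W * C (g.2.symm i) * Wᴴ * (W * ((C (g.2.symm i))ᴴ * Wᴴ))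
        = W * C (g.2.symm i) * (Wᴴ * W) * ((C (g.2.symm i))ᴴ * Wᴴ) := by simp only [mul_assoc]
      _ = _ := by rw [hW, symOp_adjoint_mul, mul_one]; simp only [mul_assoc]
  rw [h, Matrix.trace_mul_comm, ← mul_assoc, hW, symOp_adjoint_mul, one_mul]

lemma isCompact_unitaryGroup :
    IsCompact (Matrix.unitaryGroup (Fin d) ℂ : Set (Matrix (Fin d) (Fin d) ℂ)) := by
  have hb : IsCompact (Set.pi Set.univ fun _ : Fin d => Set.pi Set.univ fun _ : Fin d =>
      Metric.closedBall (0 : ℂ) 1) :=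
    isCompact_univ_pi fun _ => isCompact_univ_pi fun _ => isCompact_closedBall _ _
  refine IsCompact.of_isClosed_subset (X := Matrix (Fin d) (Fin d) ℂ) hb ?_ fun U hU i _ j _ => ?_
  · have : (Matrix.unitaryGroup (Fin d) ℂ : Set (Matrix (Fin d) (Fin d) ℂ)) =
        {U | U * Uᴴ = 1} := by
      ext U
      exact Matrix.mem_unitaryGroup_iff
    rw [this]
    exact isClosed_eq (by fun_prop) continuous_const
  · rw [mem_closedBall_zero_iff]
    exact entry_norm_bound_of_unitary hU i j

/-- The orbit is a finite union, over permutations, of continuous images of the compact set U(d). -/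
lemma isCompact_orbit (C : Fin N → Matrix (Fin d × Ports d N) (Fin d × Ports d N) ℂ) :
    IsCompact (Set.range fun g => symAct g C) := by
  have h : (Set.range fun g => symAct g C) = ⋃ ζ : Equiv.Perm (Fin N),
      (fun (U : Matrix (Fin d) (Fin d) ℂ) (i : Fin N) =>
        (U ⊗ₖ (tensorPow N (conjMat U) * permOp d ζ)) * C (ζ.symm i) *
          (U ⊗ₖ (tensorPow N (conjMat U) * permOp d ζ))ᴴ) ''
      (Matrix.unitaryGroup (Fin d) ℂ : Set (Matrix (Fin d) (Fin d) ℂ)) := by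
    ext D
    simp only [Set.mem_range, Set.mem_iUnion, Set.mem_image, Prod.exists]
    constructor
    · rintro ⟨U, ζ, rfl⟩
      exact ⟨ζ, U, U.2, rfl⟩
    · rintro ⟨ζ, U, hU, rfl⟩
      exact ⟨⟨U, hU⟩, ζ, rfl⟩
  rw [h]
  refine isCompact_iUnion fun ζ => isCompact_unitaryGroup.image ?_
  have h1 : Continuous fun U : Matrix (Fin d) (Fin d) ℂ => tensorPow N (conjMat U) := by
    refine continuous_matrix fun x y => ?_
    simp only [tensorPow, conjMat, Matrix.of_apply, Matrix.map_apply]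
    fun_prop
  have h2 : Continuous fun U : Matrix (Fin d) (Fin d) ℂ =>
      U ⊗ₖ (tensorPow N (conjMat U) * permOp d ζ) := by
    have h3 : Continuous fun U : Matrix (Fin d) (Fin d) ℂ =>
      tensorPow N (conjMat U) * permOp d ζ := h1.mul continuous_const
    refine continuous_matrix fun x y => ?_
    change Continuous fun U : Matrix (Fin d) (Fin d) ℂ =>
      U x.1 y.1 * (tensorPow N (conjMat U) * permOp d ζ) x.2 y.2
    exact (continuous_id.matrix_elem _ _).mul (h3.matrix_elem _ _)
  exact continuous_pi fun i => (h2.mul continuous_const).mul h2.matrix_conjTranspose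

/-- Every family of operators can be symmetrized by mixing finitely many of its images. -/
lemma exists_symmetrization (C : Fin N → Matrix (Fin d × Ports d N) (Fin d × Ports d N) ℂ) :
    ∃ D ∈ convexHull ℝ (Set.range fun g => symAct g C), ∀ g, symAct g D = D := by
  refine exists_fixed_mem_convexHull (isCompact_orbit C) (Set.range_nonempty _)
    strictConvexOn_hsNormSq continuous_hsNormSq (fun g => (symAct g).restrictScalars ℝ)
    ?_ fun g => hsNormSq_symAct g
  rintro g _ ⟨h, rfl⟩
  exact ⟨g * h, (symAct_mul g h C).symm⟩

/-- The sum over ports absorbs the permutation. The ports carry Ū; the input enters transposed, so U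
on A₀ also acts on X as Ū. -/
lemma portChannel_symAct (g : Matrix.unitaryGroup (Fin d) ℂ × Equiv.Perm (Fin N))
    (C : Fin N → Matrix (Fin d × Ports d N) (Fin d × Ports d N) ℂ) :
    portChannel (symAct g C) = unitaryConj (conjUnitary g.1) (portChannel C) := by
  obtain ⟨U, ζ⟩ := g
  set V : Matrix (Fin d) (Fin d) ℂ := (conjUnitary U : Matrix (Fin d) (Fin d) ℂ) with hV
  have hVV : Vᴴ * V = 1 := unitary_adjoint_mul _
  refine LinearMap.ext fun X => ext_trace fun A => ?_
  have h1 : unitaryConj (conjUnitary U) (portChannel C) X = V * portChannel C (Vᴴ * X * V) * Vᴴ :=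
    rfl
  have h2 (Y : Matrix (Fin d) (Fin d) ℂ) : (V * Y * Vᴴ * A).trace = (Y * (Vᴴ * A * V)).trace := by
    rw [mul_assoc (V * Y), mul_assoc V, Matrix.trace_mul_comm V, mul_assoc, mul_assoc]
  have h3 : (U : Matrix (Fin d) (Fin d) ℂ)ᴴ * Xᵀ * (U : Matrix (Fin d) (Fin d) ℂ) =
      (Vᴴ * X * V)ᵀ := by
    rw [Matrix.transpose_mul, Matrix.transpose_mul, ← mul_assoc]
    congr 2
    ext i j
    simp [hV, conjUnitary, conjMat]
  rw [h1, h2, trace_portChannel_mul, trace_portChannel_mul]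
  refine (Equiv.sum_comp ζ _).symm.trans (Finset.sum_congr rfl fun j _ => ?_)
  have h4 : (symOp U ζ)ᴴ * (Xᵀ ⊗ₖ atPort (ζ j) A) * symOp U ζ =
      (Vᴴ * X * V)ᵀ ⊗ₖ atPort j (Vᴴ * A * V) := by
    rw [symOp, Matrix.conjTranspose_kronecker, ← Matrix.mul_kronecker_mul,
      ← Matrix.mul_kronecker_mul, h3, Matrix.conjTranspose_mul, ← permOp_conj_atPort ζ j,
      ← tensorPow_conj_atPort _ hVV]
    simp only [mul_assoc, hV]
  rw [← h4, symAct_apply, Equiv.symm_apply_apply, mul_assoc (symOp U ζ * _), mul_assoc (symOp U ζ),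
    Matrix.trace_mul_comm (symOp U ζ)]
  simp only [mul_assoc]

/-! ### Symmetric resource states -/

/-- The vectorization identity. It turns invariance of ψ under U ⊗ Ū into invariance of its
coefficient operator under conjugation. -/
lemma coeffMat_kronecker_mulVec (A B : Matrix (Ports d N) (Ports d N) ℂ)
    (ψ : Ports d N × Ports d N → ℂ) :
    coeffMat ((A ⊗ₖ B) *ᵥ ψ) = B * coeffMat ψ * Aᵀ := by
  ext y x
  simp only [coeffMat, Matrix.of_apply, Matrix.mulVec, dotProduct, Fintype.sum_prod_type,
    Matrix.kronecker_apply, Matrix.mul_apply, Matrix.transpose_apply, Finset.sum_mul]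
  exact Finset.sum_congr rfl fun z _ => Finset.sum_congr rfl fun w _ => by ring

lemma kronecker_mulVec_eq_iff (A B : Matrix (Ports d N) (Ports d N) ℂ)
    (ψ : Ports d N × Ports d N → ℂ) :
    (A ⊗ₖ B) *ᵥ ψ = ψ ↔ B * coeffMat ψ * Aᵀ = coeffMat ψ := by
  rw [← coeffMat_kronecker_mulVec]
  refine ⟨fun h => by rw [h], fun h => ?_⟩
  ext ⟨x, y⟩
  exact congrFun₂ h y x

lemma transpose_permOp (ζ : Equiv.Perm (Fin N)) : (permOp d ζ)ᵀ = (permOp d ζ)ᴴ := by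
  ext x y
  simp [permOp_apply, apply_ite]

lemma transpose_tensorPow (U : Matrix.unitaryGroup (Fin d) ℂ) :
    (tensorPow N (U : Matrix (Fin d) (Fin d) ℂ))ᵀ =
      (tensorPow N (conjUnitary U : Matrix (Fin d) (Fin d) ℂ))ᴴ := by
  ext x y
  simp [tensorPow, conjUnitary, conjMat]

/-- In terms of the coefficient operator, symmetric vectors are those fixed by conjugation. -/
lemma isSymmetricVector_iff (ψ : Ports d N × Ports d N → ℂ) :
    IsSymmetricVector ψ ↔
      (∀ ζ : Equiv.Perm (Fin N), permOp d ζ * coeffMat ψ * (permOp d ζ)ᴴ = coeffMat ψ) ∧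
      ∀ U : Matrix.unitaryGroup (Fin d) ℂ,
        tensorPow N (U : Matrix (Fin d) (Fin d) ℂ) * coeffMat ψ *
          (tensorPow N (U : Matrix (Fin d) (Fin d) ℂ))ᴴ = coeffMat ψ := by
  refine and_congr (forall_congr' fun ζ => ?_) ⟨fun h U => ?_, fun h U => ?_⟩
  · rw [kronecker_mulVec_eq_iff, transpose_permOp]
  · have := (kronecker_mulVec_eq_iff _ _ _).1 (h (conjUnitary U))
    rwa [transpose_tensorPow, conjUnitary_conjUnitary, show conjMat
      (conjUnitary U : Matrix (Fin d) (Fin d) ℂ) = (U : Matrix (Fin d) (Fin d) ℂ) from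
      congrArg Subtype.val (conjUnitary_conjUnitary U)] at this
  · rw [kronecker_mulVec_eq_iff, transpose_tensorPow]
    exact h (conjUnitary U)

/-- The coefficient operator of the purification is √σ, which inherits the invariance of σ. -/
lemma isSymmetricVector_purification {σ : Matrix (Ports d N) (Ports d N) ℂ}
    (hσ : IsSymmetricWerner σ) : IsSymmetricVector (purification σ) := by
  rw [isSymmetricVector_iff, coeffMat_purification]
  refine ⟨fun ζ => conj_opSqrt hσ.1.1 (permOp_adjoint_mul ζ) (hσ.2.2 ζ), fun U => ?_⟩
  refine conj_opSqrt hσ.1.1 ?_ (hσ.2.1 U)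
  rw [conjTranspose_tensorPow, tensorPow_mul, unitary_adjoint_mul, tensorPow_one]

lemma mul_comm_of_conj {n : Type*} [Fintype n] [DecidableEq n] {V S : Matrix n n ℂ}
    (hV : Vᴴ * V = 1) (h : V * S * Vᴴ = S) : V * S = S * V := by
  calc V * S = V * S * (Vᴴ * V) := by rw [hV, mul_one]
    _ = S * V := by rw [← mul_assoc, h]

lemma transpose_symOp (U : Matrix.unitaryGroup (Fin d) ℂ) (ζ : Equiv.Perm (Fin N)) :
    (symOp U ζ)ᵀ = (symOp (conjUnitary U) ζ)ᴴ := by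
  rw [symOp, symOp, ← Matrix.kroneckerMap_transpose, Matrix.conjTranspose_kronecker,
    Matrix.transpose_mul, Matrix.conjTranspose_mul, transpose_permOp, transpose_tensorPow]
  congr 1
  ext i j
  simp [conjUnitary, conjMat]

/-- For a symmetric resource state the action on POVMs is an action on Choi operators. -/
lemma effectChoi_symAct {ψ : Ports d N × Ports d N → ℂ} (hψ : IsSymmetricVector ψ)
    (g : Matrix.unitaryGroup (Fin d) ℂ × Equiv.Perm (Fin N))
    (E : Fin N → Matrix (Fin d × Ports d N) (Fin d × Ports d N) ℂ) :
    (fun i => effectChoi (proj ψ) (symAct g E i)) =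
      symAct (conjUnitary g.1, g.2) fun i => effectChoi (proj ψ) (E i) := by
  obtain ⟨U, ζ⟩ := g
  rw [isSymmetricVector_iff] at hψ
  set S := coeffMat ψ with hS
  set W := symOp (conjUnitary U) ζ with hW
  have hUS := mul_comm_of_conj (V := tensorPow N (U : Matrix (Fin d) (Fin d) ℂ))
    (by rw [conjTranspose_tensorPow, tensorPow_mul, unitary_adjoint_mul, tensorPow_one]) (hψ.2 U)
  have hζS := mul_comm_of_conj (permOp_adjoint_mul ζ) (hψ.1 ζ)
  -- Symmetry of ψ says that S commutes with the group on the ports, so the group action passes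
  -- through the compression by 1 ⊗ S.
  have hcomm : W * ((1 : Matrix (Fin d) (Fin d) ℂ) ⊗ₖ S) =
      ((1 : Matrix (Fin d) (Fin d) ℂ) ⊗ₖ S) * W := by
    rw [hW, symOp, conjUnitary_conjUnitary, ← Matrix.mul_kronecker_mul, ← Matrix.mul_kronecker_mul,
      mul_one, one_mul, mul_assoc, hζS, ← mul_assoc, hUS, mul_assoc]
  have h1 : (symOp U ζ)ᵀ = Wᴴ := transpose_symOp U ζ
  have h2 : (symOp U ζ)ᴴᵀ = W := by
    have := congrArg Matrix.conjTranspose h1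
    rwa [Matrix.conjTranspose_conjTranspose] at this
  ext1 i
  rw [symAct_apply, symAct_apply, effectChoi_proj, effectChoi_proj, Matrix.transpose_mul,
    Matrix.transpose_mul, h1, h2, ← hS]
  have hcomm' := congrArg Matrix.conjTranspose hcomm
  rw [Matrix.conjTranspose_mul, Matrix.conjTranspose_mul] at hcomm'
  calc (1 ⊗ₖ S) * (W * ((E (ζ.symm i))ᵀ * Wᴴ)) * (1 ⊗ₖ S)ᴴ
      = ((1 ⊗ₖ S) * W) * (E (ζ.symm i))ᵀ * (Wᴴ * (1 ⊗ₖ S)ᴴ) := by simp only [mul_assoc]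
    _ = W * ((1 ⊗ₖ S) * (E (ζ.symm i))ᵀ * (1 ⊗ₖ S)ᴴ) * Wᴴ := by
        rw [← hcomm, ← hcomm']; simp only [mul_assoc]

/-- The channel of a protocol as a linear function of the POVM. -/
noncomputable def povmChannel (ρ : Matrix (Ports d N × Ports d N) (Ports d N × Ports d N) ℂ) :
    (Fin N → Matrix (Fin d × Ports d N) (Fin d × Ports d N) ℂ) →ₗ[ℂ]
      Matrix (Fin d) (Fin d) ℂ →ₗ[ℂ] Matrix (Fin d) (Fin d) ℂ :=
  portChannel ∘ₗ
    { toFun := fun E i => effectChoi ρ (E i)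
      map_add' := fun E E' => by
        ext i p q
        simp [effectChoi, add_mul, Finset.sum_add_distrib]
      map_smul' := fun c E => by
        ext i p q
        simp [effectChoi, Finset.mul_sum, mul_assoc] }

lemma povmChannel_symAct {ψ : Ports d N × Ports d N → ℂ} (hψ : IsSymmetricVector ψ)
    (g : Matrix.unitaryGroup (Fin d) ℂ × Equiv.Perm (Fin N))
    (E : Fin N → Matrix (Fin d × Ports d N) (Fin d × Ports d N) ℂ) :
    povmChannel (proj ψ) (symAct g E) = unitaryConj g.1 (povmChannel (proj ψ) E) := by
  have h1 : povmChannel (proj ψ) (symAct g E) =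
    portChannel fun i => effectChoi (proj ψ) (symAct g E i) := rfl
  rw [h1, effectChoi_symAct hψ, portChannel_symAct, conjUnitary_conjUnitary]
  rfl

lemma convex_isPOVM {n : Type*} [Fintype n] [DecidableEq n] :
    Convex ℝ {E : Fin N → Matrix n n ℂ | IsPOVM E} := by
  intro E hE E' hE' s t hs ht hst
  refine ⟨fun i => ((hE.1 i).smul hs).add ((hE'.1 i).smul ht), ?_⟩
  simp only [Pi.add_apply, Pi.smul_apply, Finset.sum_add_distrib, ← Finset.smul_sum, hE.2, hE'.2,
    ← add_smul, hst, one_smul]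

lemma sum_symAct (g : Matrix.unitaryGroup (Fin d) ℂ × Equiv.Perm (Fin N))
    (C : Fin N → Matrix (Fin d × Ports d N) (Fin d × Ports d N) ℂ) :
    ∑ i, symAct g C i = symOp g.1 g.2 * (∑ i, C i) * (symOp g.1 g.2)ᴴ := by
  simp only [symAct_apply, ← Finset.sum_mul, ← Finset.mul_sum]
  rw [Equiv.sum_comp g.2.symm]

lemma IsPOVM.symAct {E : Fin N → Matrix (Fin d × Ports d N) (Fin d × Ports d N) ℂ} (hE : IsPOVM E)
    (g : Matrix.unitaryGroup (Fin d) ℂ × Equiv.Perm (Fin N)) : IsPOVM (symAct g E) := by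
  refine ⟨fun i => (hE.1 _).mul_mul_conjTranspose_same _, ?_⟩
  rw [sum_symAct, hE.2, mul_one, symOp_mul_adjoint]

lemma isSymmetricPOVM_of_fixed {E : Fin N → Matrix (Fin d × Ports d N) (Fin d × Ports d N) ℂ}
    (h : ∀ g, symAct g E = E) : IsSymmetricPOVM E := by
  refine ⟨fun ζ i => ?_, fun U i => ?_⟩
  · have h1 := congrFun (h (1, ζ)) (ζ i)
    have h2 : symOp (1 : Matrix.unitaryGroup (Fin d) ℂ) ζ =
        (1 : Matrix (Fin d) (Fin d) ℂ) ⊗ₖ permOp d ζ := by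
      have : (conjUnitary (1 : Matrix.unitaryGroup (Fin d) ℂ) : Matrix (Fin d) (Fin d) ℂ) = 1 :=
        conjMat_one
      rw [symOp, this, tensorPow_one, one_mul]
      rfl
    rwa [symAct_apply, Equiv.symm_apply_apply, h2] at h1
  · have h1 := congrFun (h (U, 1)) i
    have h2 : symOp U (1 : Equiv.Perm (Fin N)) = (U : Matrix (Fin d) (Fin d) ℂ) ⊗ₖ
        tensorPow N (conjMat (U : Matrix (Fin d) (Fin d) ℂ)) := by
      rw [symOp, permOp_one, mul_one]
      rfl
    rwa [symAct_apply, h2] at h1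

/-- Symmetrization of the POVM for a symmetric resource state. -/
lemma exists_symmetric_povm (P : Protocol d N (Ports d N)) {ψ : Ports d N × Ports d N → ℂ}
    (hP : P.state = proj ψ) (hψ : IsSymmetricVector ψ) :
    ∃ P' : Protocol d N (Ports d N), P'.state = P.state ∧ IsSymmetricPOVM P'.povm ∧
      IsCovariant P'.channel ∧
      P'.channel ∈ convexHull ℝ (Set.range fun U => unitaryConj U P.channel) := by
  obtain ⟨E, hE, hfix⟩ := exists_symmetrization P.povm
  have hpovm : IsPOVM E := by
    refine convexHull_min ?_ convex_isPOVM hE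
    rintro _ ⟨g, rfl⟩
    exact P.isPOVM.symAct g
  let P' : Protocol d N (Ports d N) := ⟨P.state, E, P.isState, hpovm⟩
  have hch (Q : Protocol d N (Ports d N)) : Q.channel = povmChannel Q.state Q.povm := Q.channel_eq
  have hch' : P'.channel = povmChannel (proj ψ) E := by rw [hch, ← hP]
  refine ⟨P', rfl, isSymmetricPOVM_of_fixed hfix, fun U X => ?_, ?_⟩
  · have h1 := povmChannel_symAct hψ (U, 1) E
    rw [hfix, ← hch'] at h1
    exact LinearMap.congr_fun h1 X
  · rw [hch', hch P, hP]
    have h1 : povmChannel (proj ψ) E ∈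
        (povmChannel (proj ψ)).restrictScalars ℝ ''
          convexHull ℝ (Set.range fun g => symAct g P.povm) :=
      ⟨E, hE, rfl⟩
    rw [LinearMap.image_convexHull] at h1
    refine convexHull_mono ?_ h1
    rintro _ ⟨_, ⟨g, rfl⟩, rfl⟩
    exact ⟨g.1, (povmChannel_symAct hψ g P.povm).symm⟩

/-- The families of Choi operators of protocols. -/
def IsPortFamily (C : Fin N → Matrix (Fin d × Ports d N) (Fin d × Ports d N) ℂ) : Prop :=
  (∀ i, (C i).PosSemidef) ∧ ∃ σ, IsState σ ∧ ∑ i, C i = (1 : Matrix (Fin d) (Fin d) ℂ) ⊗ₖ σ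

/-- The marginal σ is not held fixed: it is mixed along with the family, which is how averaging
symmetrizes the resource too. -/
lemma convex_isPortFamily :
    Convex ℝ {C : Fin N → Matrix (Fin d × Ports d N) (Fin d × Ports d N) ℂ | IsPortFamily C} := by
  rintro C ⟨hC, σ, hσ, hCσ⟩ D ⟨hD, τ, hτ, hDτ⟩ s t hs ht hst
  refine ⟨fun i => ((hC i).smul hs).add ((hD i).smul ht), s • σ + t • τ,
    ⟨(hσ.1.smul hs).add (hτ.1.smul ht), ?_⟩, ?_⟩
  · rw [Matrix.trace_add, Matrix.trace_smul, Matrix.trace_smul, hσ.2, hτ.2, ← add_smul, hst,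
      one_smul]
  · simp only [Pi.add_apply, Pi.smul_apply, Finset.sum_add_distrib, ← Finset.smul_sum, hCσ, hDτ,
      Matrix.kronecker_add, Matrix.kronecker_smul]

lemma symOp_conj_one_kronecker (U : Matrix.unitaryGroup (Fin d) ℂ) (ζ : Equiv.Perm (Fin N))
    (σ : Matrix (Ports d N) (Ports d N) ℂ) :
    symOp U ζ * ((1 : Matrix (Fin d) (Fin d) ℂ) ⊗ₖ σ) * (symOp U ζ)ᴴ =
      (1 : Matrix (Fin d) (Fin d) ℂ) ⊗ₖ
        ((tensorPow N (conjUnitary U : Matrix (Fin d) (Fin d) ℂ) * permOp d ζ) * σ *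
          (tensorPow N (conjUnitary U : Matrix (Fin d) (Fin d) ℂ) * permOp d ζ)ᴴ) := by
  rw [symOp, Matrix.conjTranspose_kronecker, ← Matrix.mul_kronecker_mul,
    ← Matrix.mul_kronecker_mul, mul_one, unitary_mul_adjoint]

lemma IsPortFamily.symAct {C : Fin N → Matrix (Fin d × Ports d N) (Fin d × Ports d N) ℂ}
    (hC : IsPortFamily C) (g : Matrix.unitaryGroup (Fin d) ℂ × Equiv.Perm (Fin N)) :
    IsPortFamily (symAct g C) := by
  obtain ⟨hC, σ, hσ, hCσ⟩ := hC
  refine ⟨fun i => (hC _).mul_mul_conjTranspose_same _, _,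
    ⟨hσ.1.mul_mul_conjTranspose_same _, ?_⟩, by rw [sum_symAct, hCσ, symOp_conj_one_kronecker]⟩
  have h : (tensorPow N (conjUnitary g.1 : Matrix (Fin d) (Fin d) ℂ) * permOp d g.2)ᴴ *
      (tensorPow N (conjUnitary g.1 : Matrix (Fin d) (Fin d) ℂ) * permOp d g.2) = 1 := by
    rw [Matrix.conjTranspose_mul, mul_assoc, ← mul_assoc (tensorPow N _)ᴴ, conjTranspose_tensorPow,
      tensorPow_mul, unitary_adjoint_mul, tensorPow_one, one_mul, permOp_adjoint_mul]
  rw [Matrix.trace_mul_comm, ← mul_assoc, h, one_mul, hσ.2]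

lemma one_kronecker_injective (hd : 0 < d) {σ τ : Matrix (Ports d N) (Ports d N) ℂ}
    (h : (1 : Matrix (Fin d) (Fin d) ℂ) ⊗ₖ σ = (1 : Matrix (Fin d) (Fin d) ℂ) ⊗ₖ τ) : σ = τ := by
  ext x y
  have := congrFun₂ h (⟨0, hd⟩, x) (⟨0, hd⟩, y)
  simpa using this

/-- The sum of a fixed family is fixed, and 1 ⊗ σ determines σ because d > 0. -/
lemma isSymmetricWerner_of_fixed (hd : 0 < d)
    {C : Fin N → Matrix (Fin d × Ports d N) (Fin d × Ports d N) ℂ}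
    {σ : Matrix (Ports d N) (Ports d N) ℂ} (hσ : IsState σ)
    (hCσ : ∑ i, C i = (1 : Matrix (Fin d) (Fin d) ℂ) ⊗ₖ σ) (h : ∀ g, symAct g C = C) :
    IsSymmetricWerner σ := by
  have key (U : Matrix.unitaryGroup (Fin d) ℂ) (ζ : Equiv.Perm (Fin N)) :
      (tensorPow N (U : Matrix (Fin d) (Fin d) ℂ) * permOp d ζ) * σ *
          (tensorPow N (U : Matrix (Fin d) (Fin d) ℂ) * permOp d ζ)ᴴ = σ := by
    refine one_kronecker_injective hd ?_
    have := symOp_conj_one_kronecker (conjUnitary U) ζ σ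
    rw [conjUnitary_conjUnitary] at this
    rw [← this, ← hCσ, ← sum_symAct (conjUnitary U, ζ), h]
  refine ⟨hσ, fun U => ?_, fun ζ => ?_⟩
  · simpa [permOp_one] using key U 1
  · have := key 1 ζ
    rwa [Matrix.UnitaryGroup.one_val, tensorPow_one, one_mul] at this

/-- Every protocol can be replaced by one with a symmetric pure resource state. -/
lemma exists_symmetric_resource (hd : 0 < d) (hN : 0 < N) {a : Type*} [Fintype a] [DecidableEq a]
    (P : Protocol d N a) :
    ∃ (P' : Protocol d N (Ports d N)) (ψ : Ports d N × Ports d N → ℂ),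
      P'.state = proj ψ ∧ IsSymmetricVector ψ ∧ IsSymmetricWerner (bobMarginal P'.state) ∧
      P'.channel ∈ convexHull ℝ (Set.range fun U => unitaryConj U P.channel) := by
  set C₀ := fun i => effectChoi P.state (P.povm i) with hC₀
  have hC₀f : IsPortFamily C₀ :=
    ⟨fun i => effectChoi_posSemidef P.isState.1 (P.isPOVM.1 i), bobMarginal P.state,
      ⟨bobMarginal_posSemidef P.isState.1, (trace_bobMarginal _).trans P.isState.2⟩,
      P.sum_effectChoi⟩
  -- Averaging is done on the Choi operators, so no register recording the group element is added to
  -- Alice's system. A protocol is rebuilt from the result afterwards.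
  obtain ⟨C, hC, hfix⟩ := exists_symmetrization C₀
  obtain ⟨hCp, σ, hσ, hCσ⟩ : IsPortFamily C := by
    refine convexHull_min ?_ convex_isPortFamily hC
    rintro _ ⟨g, rfl⟩
    exact hC₀f.symAct g
  have hW := isSymmetricWerner_of_fixed hd hσ hCσ hfix
  obtain ⟨P', hP', hch⟩ := exists_protocol_effectChoi_eq hN hCp hσ hCσ
  refine ⟨P', purification σ, hP', isSymmetricVector_purification hW, ?_, ?_⟩
  · rwa [hP', bobMarginal_purification hσ.1]
  · rw [P'.channel_eq, P.channel_eq, funext hch]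
    have h1 : portChannel C ∈
        portChannel.restrictScalars ℝ '' convexHull ℝ (Set.range fun g => symAct g C₀) :=
      ⟨C, hC, rfl⟩
    rw [LinearMap.image_convexHull] at h1
    refine convexHull_mono ?_ h1
    rintro _ ⟨_, ⟨g, rfl⟩, rfl⟩
    exact ⟨conjUnitary g.1, (portChannel_symAct g C₀).symm⟩

end Symmetrization

/-! ### Compactness, existence of the optima and the relation between them. -/

section Optima

variable {d N : ℕ} {a b : Type*} [Fintype a] [DecidableEq a] [Fintype b] [DecidableEq b]

/-- Relabelling the basis of Alice's system. -/
def Protocol.reindex (P : Protocol d N a) (e : a ≃ b) : Protocol d N b where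
  state := P.state.submatrix (e.symm.prodCongr (Equiv.refl _)) (e.symm.prodCongr (Equiv.refl _))
  povm i := (P.povm i).submatrix ((Equiv.refl _).prodCongr e.symm) ((Equiv.refl _).prodCongr e.symm)
  isState := ⟨P.isState.1.submatrix _, by
    rw [← P.isState.2]
    exact Equiv.sum_comp (e.symm.prodCongr (Equiv.refl _)) fun p => P.state p p⟩
  isPOVM := ⟨fun i => (P.isPOVM.1 i).submatrix _, by
    have := congrArg (fun M => M.submatrix ((Equiv.refl (Fin d)).prodCongr e.symm)
      ((Equiv.refl _).prodCongr e.symm)) P.isPOVM.2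
    rw [Matrix.submatrix_one_equiv] at this
    rw [← this]
    ext p q
    simp [Matrix.sum_apply]⟩

lemma Protocol.channel_reindex (P : Protocol d N a) (e : a ≃ b) :
    (P.reindex e).channel = P.channel := by
  rw [Protocol.channel_eq, Protocol.channel_eq]
  congr 1
  ext i p q
  simp only [effectChoi, Protocol.reindex, Matrix.of_apply, Matrix.submatrix_apply,
    Equiv.prodCongr_apply, Prod.map, Equiv.refl_apply]
  refine Fintype.sum_equiv e.symm _ _ fun k => Fintype.sum_equiv e.symm _ _ fun k' => rfl

/-- With M = SS†, an entry is the inner product of two rows of S, and each row has squared norm at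
most tr M. This gives the boundedness needed for compactness. -/
lemma norm_apply_le_trace {M : Matrix a a ℂ} (hM : M.PosSemidef) (i j : a) :
    ‖M i j‖ ≤ M.trace.re := by
  set S := opSqrt M with hS
  have hSS : S * Sᴴ = M := by rw [hS, conjTranspose_opSqrt, opSqrt_mul_opSqrt hM]
  have htr : M.trace.re = ∑ x, ∑ k, ‖S x k‖ ^ 2 := by
    rw [← hSS]
    simp [Matrix.trace, Matrix.mul_apply, ← Complex.normSq_eq_norm_sq, Complex.normSq_apply]
  have hrow (x : a) : ∑ k, ‖S x k‖ ^ 2 ≤ M.trace.re := by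
    rw [htr]
    exact Finset.single_le_sum (f := fun x => ∑ k, ‖S x k‖ ^ 2)
      (fun x _ => Finset.sum_nonneg fun k _ => sq_nonneg _) (Finset.mem_univ x)
  have h1 : M i j = ∑ k, S i k * star (S j k) := by
    rw [← hSS]; rfl
  calc ‖M i j‖ ≤ ∑ k, ‖S i k‖ * ‖S j k‖ := by
        rw [h1]
        refine (norm_sum_le _ _).trans_eq ?_
        simp
    _ ≤ ∑ k, (‖S i k‖ ^ 2 + ‖S j k‖ ^ 2) / 2 :=
        Finset.sum_le_sum fun k _ => by nlinarith [sq_nonneg (‖S i k‖ - ‖S j k‖)]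
    _ = (∑ k, ‖S i k‖ ^ 2 + ∑ k, ‖S j k‖ ^ 2) / 2 := by
        rw [← Finset.sum_add_distrib, Finset.sum_div]
    _ ≤ M.trace.re := by linarith [hrow i, hrow j]

lemma isClosed_posSemidef : IsClosed {M : Matrix a a ℂ | M.PosSemidef} := by
  simp only [Matrix.posSemidef_iff_dotProduct_mulVec, Set.ofPred_and, Set.ofPred_forall]
  refine IsClosed.inter (isClosed_eq (by fun_prop) continuous_id) (isClosed_iInter fun x => ?_)
  have hc : Continuous fun M : Matrix a a ℂ => star x ⬝ᵥ M *ᵥ x :=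
    continuous_const.dotProduct (continuous_id.matrix_mulVec continuous_const)
  simp only [Complex.le_def]
  exact (isClosed_le continuous_const (Complex.continuous_re.comp hc)).inter
    (isClosed_eq continuous_const (Complex.continuous_im.comp hc))

lemma isCompact_posSemidef_trace_le (t : ℝ) :
    IsCompact {M : Matrix a a ℂ | M.PosSemidef ∧ M.trace.re ≤ t} := by
  have hb : IsCompact (Set.pi Set.univ fun _ : a => Set.pi Set.univ fun _ : a =>
      Metric.closedBall (0 : ℂ) t) :=
    isCompact_univ_pi fun _ => isCompact_univ_pi fun _ => isCompact_closedBall _ _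
  refine IsCompact.of_isClosed_subset (X := Matrix a a ℂ) hb ?_ fun M hM i _ j _ => ?_
  · exact isClosed_posSemidef.inter (isClosed_le
      (Complex.continuous_re.comp (continuous_id.matrix_trace)) continuous_const)
  · rw [mem_closedBall_zero_iff]
    exact (norm_apply_le_trace hM.1 i j).trans hM.2

lemma isCompact_isState : IsCompact {ρ : Matrix a a ℂ | IsState ρ} := by
  refine (isCompact_posSemidef_trace_le (a := a) 1).of_isClosed_subset ?_ fun ρ hρ => ⟨hρ.1, ?_⟩
  · exact isClosed_posSemidef.inter (isClosed_eq continuous_id.matrix_trace continuous_const)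
  · rw [hρ.2, Complex.one_re]

lemma isCompact_isPOVM : IsCompact {E : Fin N → Matrix a a ℂ | IsPOVM E} := by
  refine (isCompact_univ_pi fun _ : Fin N =>
    isCompact_posSemidef_trace_le (a := a) (Fintype.card a)).of_isClosed_subset ?_
    fun E hE i _ => ⟨hE.1 i, ?_⟩
  · simp only [IsPOVM, Set.ofPred_and, Set.ofPred_forall]
    exact (isClosed_iInter fun i =>
      (isClosed_posSemidef (a := a)).preimage (continuous_apply i)).inter
      (isClosed_eq (continuous_finsetSum _ fun i _ => continuous_apply i) continuous_const)
  · have h : ∑ j, (E j).trace.re = Fintype.card a := by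
      rw [← Complex.re_sum, ← Matrix.trace_sum, hE.2, Matrix.trace_one, Complex.natCast_re]
    rw [← h]
    exact Finset.single_le_sum (f := fun j => (E j).trace.re)
      (fun j _ => (Complex.le_def.1 (hE.1 j).trace_nonneg).1) (Finset.mem_univ i)

/-- With Alice's dimension fixed, states and POVMs form compact sets, and on protocols the fidelity
is the real part of an expression bilinear in the two. -/
lemma exists_isGreatest_portFidelities (hd : 0 < d) (hN : 0 < N) :
    ∃ x, IsGreatest (portFidelities d N) x := by
  have : Nonempty (Fin d) := ⟨⟨0, hd⟩⟩
  let K := {ρ : Matrix (Ports d N × Ports d N) (Ports d N × Ports d N) ℂ | IsState ρ} ×ˢ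
    {E : Fin N → Matrix (Fin d × Ports d N) (Fin d × Ports d N) ℂ | IsPOVM E}
  have hK : IsCompact K := isCompact_isState.prod isCompact_isPOVM
  let F : Matrix (Ports d N × Ports d N) (Ports d N × Ports d N) ℂ ×
      (Fin N → Matrix (Fin d × Ports d N) (Fin d × Ports d N) ℂ) → ℝ := fun p =>
    ((Fintype.card (Fin d) : ℂ)⁻¹ ^ 2 * ∑ k, ∑ l, portChannel (fun i => effectChoi p.1 (p.2 i))
      (Matrix.single k l 1) k l).re
  have hF (P : Protocol d N (Ports d N)) : entFidelity P.channel = F (P.state, P.povm) := by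
    rw [entFidelity_eq_sum P.isChannel, P.channel_eq]
  have hFc : Continuous F := by
    have h (i : Fin N) (x y : Fin d × Ports d N) :
        Continuous fun p : Matrix (Ports d N × Ports d N) (Ports d N × Ports d N) ℂ ×
          (Fin N → Matrix (Fin d × Ports d N) (Fin d × Ports d N) ℂ) =>
          effectChoi p.1 (p.2 i) x y := by
      simp only [effectChoi, Matrix.of_apply]
      fun_prop
    simp only [F, portChannel_single_apply]
    refine Complex.continuous_re.comp (continuous_const.mul (continuous_finsetSum _ fun k _ =>
      continuous_finsetSum _ fun l _ => continuous_finsetSum _ fun i _ =>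
      continuous_finsetSum _ fun y _ => ?_))
    split_ifs
    · exact h i _ _
    · exact continuous_const
  -- A basis vector as resource and the uniform POVM that ignores Alice's systems.
  have hne : K.Nonempty := by
    let z : Ports d N × Ports d N := (fun _ => ⟨0, hd⟩, fun _ => ⟨0, hd⟩)
    refine ⟨(proj (Pi.single z 1), fun _ => (N : ℂ)⁻¹ • 1), ⟨proj_posSemidef _, ?_⟩,
      fun i => Matrix.PosSemidef.one.smul (by positivity), ?_⟩
    · exact trace_proj (by simp)
    · have hN' : (N : ℂ) ≠ 0 := by exact_mod_cast hN.ne'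
      rw [Finset.sum_const, Finset.card_univ, Fintype.card_fin, ← Nat.cast_smul_eq_nsmul ℂ,
        smul_smul, mul_inv_cancel₀ hN', one_smul]
  obtain ⟨⟨ρ, E⟩, ⟨hρ, hE⟩, hmax⟩ := hK.exists_isMaxOn hne hFc.continuousOn
  refine ⟨F (ρ, E), ⟨⟨ρ, E, hρ, hE⟩, (hF ⟨ρ, E, hρ, hE⟩).symm⟩, ?_⟩
  rintro x ⟨P, rfl⟩
  rw [hF]
  exact hmax ⟨P.isState, P.isPOVM⟩

lemma exists_symmetric_protocol_of_symmetric_resource (hd : 0 < d) (P : Protocol d N (Ports d N))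
    {ψ : Ports d N × Ports d N → ℂ} (hP : P.state = proj ψ) (hψ : IsSymmetricVector ψ) :
    ∃ P' : Protocol d N (Ports d N), P'.state = P.state ∧ IsSymmetricPOVM P'.povm ∧
      IsCovariant P'.channel ∧ NoWorse P'.channel P.channel := by
  have : Nonempty (Fin d) := ⟨⟨0, hd⟩⟩
  obtain ⟨P', h1, h2, h3, h4⟩ := exists_symmetric_povm P hP hψ
  exact ⟨P', h1, h2, h3, noWorse_of_isCovariant P.isChannel P'.isChannel h3
    fun f hf => hf.le_of_mem_convexHull P.isChannel h4⟩

/-- Two averagings in succession: the first makes the resource symmetric, the second leaves that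
resource untouched and symmetrizes the POVM. Convex invariant functions do not increase in either.
-/
lemma exists_symmetric_protocol (hd : 0 < d) (hN : 0 < N) (P : Protocol d N a) :
    ∃ (P' : Protocol d N (Ports d N)) (ψ : Ports d N × Ports d N → ℂ),
      P'.state = proj ψ ∧ IsSymmetricVector ψ ∧ IsSymmetricWerner (bobMarginal P'.state) ∧
      IsSymmetricPOVM P'.povm ∧ IsCovariant P'.channel ∧ NoWorse P'.channel P.channel := by
  have : Nonempty (Fin d) := ⟨⟨0, hd⟩⟩
  obtain ⟨P₁, ψ, hP₁, hψ, hW, hch₁⟩ := exists_symmetric_resource hd hN P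
  obtain ⟨P', h1, h2, h3, h4⟩ := exists_symmetric_povm P₁ hP₁ hψ
  exact ⟨P', ψ, h1.trans hP₁, hψ, by rwa [h1], h2, h3,
    noWorse_of_isCovariant P.isChannel P'.isChannel h3 fun f hf =>
      (hf.le_of_mem_convexHull P₁.isChannel h4).trans
        (hf.le_of_mem_convexHull P.isChannel hch₁)⟩

lemma optError_eq_two_mul_one_sub_optFidelity (hd : 0 < d) (hN : 0 < N) :
    IsGreatest (fidelities d N) (optFidelity d N) ∧
      IsGreatest (portFidelities d N) (optFidelity d N) ∧
      IsLeast (errors d N) (optError d N) ∧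
      IsLeast (portErrors d N) (optError d N) ∧
      optError d N = 2 * (1 - optFidelity d N) := by
  have : Nonempty (Fin d) := ⟨⟨0, hd⟩⟩
  obtain ⟨x, hx⟩ := exists_isGreatest_portFidelities hd hN
  have hle {n : ℕ} (P : Protocol d N (Fin n)) : entFidelity P.channel ≤ x := by
    obtain ⟨P', -, -, -, -, -, -, hP'⟩ := exists_symmetric_protocol hd hN P
    exact hP'.1.trans (hx.2 ⟨P', rfl⟩)
  let e := Fintype.equivFin (Ports d N)
  have hF : IsGreatest (fidelities d N) x := by
    refine ⟨?_, ?_⟩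
    · obtain ⟨P, rfl⟩ := hx.1
      exact ⟨_, P.reindex e, by rw [P.channel_reindex]⟩
    · rintro _ ⟨n, P, rfl⟩
      exact hle P
  have hxF : optFidelity d N = x := hF.csSup_eq
  have hlb : 2 * (1 - x) ∈ lowerBounds (errors d N) := by
    rintro _ ⟨n, P, rfl⟩
    have := two_mul_one_sub_entFidelity_le P.isChannel
    linarith [hle P]
  -- Symmetrizing a maximizer of the fidelity keeps it a maximizer and makes its channel covariant,
  -- so its error is exactly 2(1 - x).
  have hport : 2 * (1 - x) ∈ portErrors d N := by
    obtain ⟨P, hP⟩ := hx.1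
    obtain ⟨P', -, -, -, -, -, hc, hP'⟩ := exists_symmetric_protocol hd hN P
    refine ⟨P', ?_⟩
    rw [P'.isChannel.diamondError_of_isCovariant hc,
      le_antisymm (hx.2 ⟨P', rfl⟩) (hP.le.trans hP'.1)]
  have hsub : portErrors d N ⊆ errors d N := by
    rintro _ ⟨P, rfl⟩
    exact ⟨_, P.reindex e, by rw [P.channel_reindex]⟩
  have hE : IsLeast (errors d N) (2 * (1 - x)) := ⟨hsub hport, hlb⟩
  have hxE : optError d N = 2 * (1 - x) := hE.csInf_eq
  rw [hxE, hxF]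
  exact ⟨hF, hx, hE, ⟨hport, fun y hy => hlb (hsub hy)⟩, rfl⟩

end Optima
end PBT

theorem mainTheorem9 (d N : ℕ) (hd : 0 < d) (hN : 0 < N) :
    -- every protocol can be transformed into a fully symmetric one that is no worse
    (∀ {a : Type*} [Fintype a] [DecidableEq a] (P : PBT.Protocol d N a),
      ∃ (P' : PBT.Protocol d N (PBT.Ports d N)) (ψ : PBT.Ports d N × PBT.Ports d N → ℂ),
        P'.state = PBT.proj ψ ∧ PBT.IsSymmetricVector ψ ∧
        PBT.IsSymmetricWerner (PBT.bobMarginal P'.state) ∧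
        PBT.IsSymmetricPOVM P'.povm ∧
        PBT.IsCovariant P'.channel ∧
        PBT.NoWorse P'.channel P.channel) ∧
    -- for a symmetric resource state, the POVM alone can be symmetrized
    (∀ (P : PBT.Protocol d N (PBT.Ports d N)) (ψ : PBT.Ports d N × PBT.Ports d N → ℂ),
      P.state = PBT.proj ψ → PBT.IsSymmetricVector ψ →
      ∃ P' : PBT.Protocol d N (PBT.Ports d N),
        P'.state = P.state ∧
        PBT.IsSymmetricPOVM P'.povm ∧
        PBT.IsCovariant P'.channel ∧
        PBT.NoWorse P'.channel P.channel) ∧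
    -- the optima exist, whichever system Alice may use, and they determine each other
    (IsGreatest (PBT.fidelities d N) (PBT.optFidelity d N) ∧
      IsGreatest (PBT.portFidelities d N) (PBT.optFidelity d N) ∧
      IsLeast (PBT.errors d N) (PBT.optError d N) ∧
      IsLeast (PBT.portErrors d N) (PBT.optError d N) ∧
      PBT.optError d N = 2 * (1 - PBT.optFidelity d N)) :=
  ⟨fun P => PBT.exists_symmetric_protocol hd hN P,
    fun P _ hP hψ => PBT.exists_symmetric_protocol_of_symmetric_resource hd P hP hψ,
    PBT.optError_eq_two_mul_one_sub_optFidelity hd hN⟩
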